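/- **Theorem ($H^1$-estimate for the viscous-plastic sea-ice momentum equation).** Let $\Omega\subset\mathbb R^2$ be open and bounded, and write $\|\cdot\|$ for the $L^2(\Omega)$ norm. There are positive constants $c_k$ and $c_p$, depending only on $\Omega$, with Korn's inequality $\tfrac14\|\nabla\mathbf w+\nabla\mathbf w^T\|^2\ge c_k\|\nabla \mathbf w\|^2$ and Poincaré's inequality $\|\mathbf w\|^2\le c_p\|\nabla \mathbf w\|^2$ for all $\mathbf w\in H^1_0(\Omega)^2$ (moreover $c_k$ may be any positive constant for which Korn's inequality holds, with the same $c_p$), such that the following is true. Let $T>0$, let the mean ice thickness $h>0$ and the ice concentration $A>0$ be constant in time and space, let $\rho,\rho_a,\rho_w,C_a,C_w,P^*,C,\Delta_{\min}>0$, let $f\in\mathbb R$ be the constant Coriolis parameter, and let $C_{w1}=C_w s_0$ with a fixed scaling speed $s_0\ge 0$ (linearized water drag). Let $\mathbf v_a,\mathbf v_w$ be the air and ocean velocities on $[0,T]\times\Omega$, with $e_r\times(w_1,w_2)=(-w_2,w_1)$, and assume that $$\mathcal R:=\rho_aC_a|\mathbf v_a|\mathbf v_a+\rho_wC_{w1}\mathbf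 v_w+\rho h f\, e_r\times\mathbf v_w\in L^2([0,T]\times\Omega)^2 .$$ Let $\mathbf v\in L^2([0,T],H^1_0(\Omega)^2)$, with $\mathbf v(t)\in L^2(\Omega)^2$ for every $t\in[0,T]$, be a weak solution of $$\rho h\,\partial_t\mathbf v=\operatorname{div}\sigma+\rho_aC_a|\mathbf v_a|\mathbf v_a+\rho_wC_{w1}(\mathbf v_w-\mathbf v)+\rho hf\,e_r\times\mathbf v_w-\rho hf\,e_r\times\mathbf v ,$$ that is, with $\mathbf F$ the sum of the terms after $\operatorname{div}\sigma$, for all $\phi\in H^1_0(\Omega)^2$ and all $t\in[0,T]$ $$\rho h\,(\mathbf v(t),\phi)-\rho h\,(\mathbf v(0),\phi)=\int_0^t\big\{(\mathbf F,\phi)-(\sigma,\nabla\phi)\big\}\,ds .$$ Here the stress is viscous-plastic: with $\dot\epsilon=\tfrac12(\nabla\mathbf v+\nabla\mathbf v^T)$, $\dot\epsilon'=\dot\epsilon-\tfrac12\operatorname{tr}(\dot\epsilon)I$, $e=2$, $$\sigma=2\eta\dot\epsilon+(\zeta-\eta)\operatorname{tr}(\dot\epsilon)I-\tfrac P2 I,\quad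 P=P^*he^{-C(1-A)},\quad \zeta=\tfrac{P}{2\Delta},\quad \eta=\zeta e^{-2},\quad \Delta=\sqrt{\Delta_{\min}^2+2e^{-2}\,\dot\epsilon':\dot\epsilon'+\operatorname{tr}(\dot\epsilon)^2}$$ (in $P$, $e^{-C(1-A)}$ denotes the exponential function; in $\eta$ and $\Delta$, $e=2$ is the eccentricity of the yield curve). Assume that the minimal viscosity $\zeta_{\min}$, the essential infimum of $\zeta$ over $\Omega\times[0,T]$, is positive. Then $$\rho h\|\mathbf v(T)\|^2+\int_0^T\Big\{2\rho_wC_{w1}\|\mathbf v\|^2+c_k\frac{\zeta_{\min}}4\|\nabla\mathbf v\|^2\Big\}dt\le\int_0^T\frac{c_p}{c_k\zeta_{\min}}\|\mathcal R\|^2\,dt+\rho h\|\mathbf v(0)\|^2 .$$ -/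

import Mathlib

open MeasureTheory Set Filter Topology
open scoped ContDiff

noncomputable section

namespace SeaIce

/-- The plane with its Euclidean norm. -/
abbrev Plane : Type := EuclideanSpace ℝ (Fin 2)

/-- Real 2 × 2 tensors with the Frobenius inner product `G : H = ∑ G i j * H i j`. -/
abbrev Tensor : Type := EuclideanSpace ℝ (Fin 2 × Fin 2)

/-- Identity tensor. -/
def idTensor : Tensor := WithLp.toLp 2 fun ij => if ij.1 = ij.2 then 1 else 0

/-- Trace of a tensor. -/
def tr (G : Tensor) : ℝ := G (0, 0) + G (1, 1)

/-- Symmetric part `(G + Gᵀ) / 2`; applied to a velocity gradient this is the strain rate. -/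
def sym (G : Tensor) : Tensor := WithLp.toLp 2 fun ij => (G ij + G (ij.2, ij.1)) / 2

/-- Deviatoric part `ε - (tr ε / 2) I`. -/
def dev (ε : Tensor) : Tensor := ε - (tr ε / 2) • idTensor

/-- `e_r × w` for a horizontal vector `w`, with `e_r` the vertical unit vector. -/
def cross (w : Plane) : Plane := !₂[-(w 1), w 0]

/-- Classical gradient: the entry `(i, j)` is `∂_j ψ_i`. -/
def grad (ψ : Plane → Plane) (x : Plane) : Tensor :=
  WithLp.toLp 2 fun ij => (fderiv ℝ ψ x (EuclideanSpace.single ij.2 1)) ij.1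

/-- Square of the `L²(Ω)` norm. -/
def normSq {F : Type*} [NormedAddCommGroup F] (Ω : Set Plane) (f : Plane → F) : ℝ :=
  ∫ x in Ω, ‖f x‖ ^ 2

/-- `φ ∈ H¹₀(Ω)²` with weak gradient `Dφ`: the pair `(φ, Dφ)` is a limit in `L² × L²` of pairs
`(ψ, ∇ψ)` with `ψ` smooth and compactly supported in `Ω`. -/
structure MemH10 (Ω : Set Plane) (φ : Plane → Plane) (Dφ : Plane → Tensor) : Prop where
  memLp : MemLp φ 2 (volume.restrict Ω)
  memLp_grad : MemLp Dφ 2 (volume.restrict Ω)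
  approx : ∃ ψ : ℕ → Plane → Plane,
    (∀ n, ContDiff ℝ ∞ (ψ n) ∧ HasCompactSupport (ψ n) ∧ tsupport (ψ n) ⊆ Ω) ∧
    Tendsto (fun n => eLpNorm (ψ n - φ) 2 (volume.restrict Ω)) atTop (𝓝 0) ∧
    Tendsto (fun n => eLpNorm (grad (ψ n) - Dφ) 2 (volume.restrict Ω)) atTop (𝓝 0)

/-- Lebesgue measure on `(0, T] × Ω`. -/
def spaceTime (Ω : Set Plane) (T : ℝ) : Measure (ℝ × Plane) :=
  (volume.restrict (Ioc 0 T)).prod (volume.restrict Ω)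

/-- `v ∈ L²([0, T], H¹₀(Ω)²)` with (spatial) weak gradient `Dv`. -/
structure MemL2H10 (Ω : Set Plane) (T : ℝ) (v : ℝ → Plane → Plane) (Dv : ℝ → Plane → Tensor) :
    Prop where
  memLp : MemLp (Function.uncurry v) 2 (spaceTime Ω T)
  memLp_grad : MemLp (Function.uncurry Dv) 2 (spaceTime Ω T)
  ae_mem : ∀ᵐ t ∂(volume.restrict (Ioc 0 T)), MemH10 Ω (v t) (Dv t)

/-- Korn's first inequality on `H¹₀(Ω)²` with constant `ck`. -/
def Korn (Ω : Set Plane) (ck : ℝ) : Prop :=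
  ∀ φ Dφ, MemH10 Ω φ Dφ → ck * normSq Ω Dφ ≤ normSq Ω (fun x => sym (Dφ x))

/-- Poincaré's inequality on `H¹₀(Ω)²` with constant `cp`. -/
def Poincare (Ω : Set Plane) (cp : ℝ) : Prop :=
  ∀ φ Dφ, MemH10 Ω φ Dφ → normSq Ω φ ≤ cp * normSq Ω Dφ

/-- Physical parameters, together with the constant thickness `h` and concentration `A`. -/
structure Params where
  /-- sea-ice density -/
  ρ : ℝ
  /-- air density -/
  ρa : ℝ
  /-- water density -/
  ρw : ℝ
  /-- wind drag coefficient -/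
  Ca : ℝ
  /-- water drag coefficient -/
  Cw : ℝ
  /-- fixed scaling speed of the linearized water drag -/
  speed : ℝ
  /-- Coriolis parameter -/
  f : ℝ
  /-- mean sea-ice thickness -/
  h : ℝ
  /-- sea-ice concentration -/
  A : ℝ
  /-- ice strength parameter -/
  Pstar : ℝ
  /-- ice concentration parameter -/
  C : ℝ
  /-- threshold of the viscous regime -/
  Δmin : ℝ
  ρ_pos : 0 < ρ
  ρa_pos : 0 < ρa
  ρw_pos : 0 < ρw
  Ca_pos : 0 < Ca
  Cw_pos : 0 < Cw
  speed_nonneg : 0 ≤ speed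
  h_pos : 0 < h
  A_pos : 0 < A
  Pstar_pos : 0 < Pstar
  C_pos : 0 < C
  Δmin_pos : 0 < Δmin

namespace Params

variable (p : Params)

/-- Coefficient of the linearized water drag. -/
def Cw1 : ℝ := p.Cw * p.speed

/-- Ice strength. -/
def P : ℝ := p.Pstar * p.h * Real.exp (-p.C * (1 - p.A))

/-- Eccentricity of the elliptic yield curve. -/
def ecc : ℝ := 2

/-- Regularized total deformation, as a function of the strain rate `ε`. -/
def Δ (ε : Tensor) : ℝ :=
  Real.sqrt (p.Δmin ^ 2 + 2 * (ecc ^ 2)⁻¹ * ‖dev ε‖ ^ 2 + tr ε ^ 2)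

/-- Bulk viscosity. -/
def ζ (ε : Tensor) : ℝ := p.P / (2 * p.Δ ε)

/-- Shear viscosity. -/
def η (ε : Tensor) : ℝ := p.ζ ε * (ecc ^ 2)⁻¹

/-- Viscous-plastic stress, as a function of the strain rate `ε`. -/
def σ (ε : Tensor) : Tensor :=
  (2 * p.η ε) • ε + ((p.ζ ε - p.η ε) * tr ε) • idTensor - (p.P / 2) • idTensor

/-- Wind stress plus linearized ocean stress, at air, water and ice velocities `a`, `w`, `u`. -/
def τ (a w u : Plane) : Plane :=
  (p.ρa * p.Ca * ‖a‖) • a + (p.ρw * p.Cw1) • (w - u)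

/-- External forces: stresses, surface tilt (`-ρ h g ∇H_d = ρ h f e_r × w` by geostrophic
balance) and Coriolis force. -/
def force (a w u : Plane) : Plane :=
  p.τ a w u + (p.ρ * p.h * p.f) • cross w - (p.ρ * p.h * p.f) • cross u

/-- The part of the external forces that does not depend on the ice velocity. -/
def R (a w : Plane) : Plane :=
  (p.ρa * p.Ca * ‖a‖) • a + (p.ρw * p.Cw1) • w + (p.ρ * p.h * p.f) • cross w

/-- Minimal (essential infimum) bulk viscosity on `Ω × [0, T]` of a flow with gradient `Dv`. -/
def ζmin (Ω : Set Plane) (T : ℝ) (Dv : ℝ → Plane → Tensor) : ℝ :=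
  essInf (fun z : ℝ × Plane => p.ζ (sym (Dv z.1 z.2))) (spaceTime Ω T)

/-- `v ∈ L²([0, T], H¹₀(Ω)²)`, with gradient `Dv`, is a weak solution on `[0, T]` of the momentum
equation `ρ h ∂ₜ v = div σ + F`. The identity says that, for each `φ ∈ H¹₀(Ω)²`, the function
`t ↦ (ρ h v(t), φ)` is absolutely continuous on `[0, T]` with
`d/dt (ρ h v, φ) = (F, φ) - (σ, ∇φ)` almost everywhere. In particular `v(0)` and `v(T)` are
the values of the weakly continuous representative. -/
structure IsWeakSolution (Ω : Set Plane) (T : ℝ) (va vw : ℝ → Plane → Plane)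
    (v : ℝ → Plane → Plane) (Dv : ℝ → Plane → Tensor) : Prop where
  memL2H10 : MemL2H10 Ω T v Dv
  memLp_slice : ∀ t ∈ Icc 0 T, MemLp (v t) 2 (volume.restrict Ω)
  weak_eq : ∀ φ Dφ, MemH10 Ω φ Dφ → ∀ t ∈ Icc 0 T,
    p.ρ * p.h * (∫ x in Ω, inner ℝ (v t x) (φ x)) - p.ρ * p.h * (∫ x in Ω, inner ℝ (v 0 x) (φ x)) =
      ∫ s in (0 : ℝ)..t,
        ((∫ x in Ω, inner ℝ (p.force (va s x) (vw s x) (v s x)) (φ x)) -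
          ∫ x in Ω, inner ℝ (p.σ (sym (Dv s x))) (Dφ x))

end Params

end SeaIce

end

/-! ### Time-translated `L²` pairings. -/

section Pairing

variable {α X E : Type*} [MeasurableSpace α] [NormedAddCommGroup E] [InnerProductSpace ℝ E]

/-! The estimate is the energy inequality for the momentum equation, obtained by testing with `v`
itself. The Coriolis force does no work, the drag gives the dissipation of `‖v‖²`, the viscous
stress dominates `ck * ζmin * ‖∇v‖²` by Korn, and the pressure drops out because the divergence of
an `H¹₀` field has mean zero. Young and Poincaré absorb the work of `R` into half of the viscous
dissipation.

The difficulty is that `v(t)` depends on time while the weak equation admits only fixed test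
functions, and nothing is assumed about `∂ₜ v`. In `energy_inequality` the equation between the
times `t - δ` and `t` is tested with the frozen `v(t)`, and convexity, `‖b‖² - ‖a‖² ≤ 2 (b - a, b)`,
takes the place of the chain rule. After integration over `t` the left side telescopes to boundary
layers at `0` and `T`, and the right side becomes `∫₀^δ Φ`, where `Φ(u)` pairs forces and stresses
delayed by `u` with `(v, ∇v)`. Translations are continuous in `L²`, so division by `δ → 0` yields `Φ
0`. Weak continuity of `v` at `T`, with density of test functions in `L²`, recovers `‖v(T)‖²`. -/

theorem MeasureTheory.MemLp.integrable_inner_two {μ : Measure α} {f g : α → E}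
    (hf : MemLp f 2 μ) (hg : MemLp g 2 μ) : Integrable (fun x => inner ℝ (f x) (g x)) μ := by
  refine (L2.integrable_inner (𝕜 := ℝ) (hf.toLp f) (hg.toLp g)).congr ?_
  filter_upwards [hf.coeFn_toLp, hg.coeFn_toLp] with x h1 h2
  rw [h1, h2]

theorem MeasureTheory.MemLp.integrable_norm_sq {E : Type*} [NormedAddCommGroup E] {μ : Measure α}
    {f : α → E} (hf : MemLp f 2 μ) : Integrable (fun x => ‖f x‖ ^ 2) μ :=
  (memLp_two_iff_integrable_sq_norm hf.1).1 hf

theorem MeasureTheory.MemLp.ae_slice {E : Type*} [NormedAddCommGroup E] {β : Type*}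
    [MeasurableSpace β] {ν : Measure β} [SFinite ν]
    {μ : Measure α} [SFinite μ] {f : β → α → E}
    (hf : MemLp (Function.uncurry f) 2 (ν.prod μ)) : ∀ᵐ t ∂ν, MemLp (f t) 2 μ := by
  have h := ((memLp_two_iff_integrable_sq_norm hf.1).1 hf).prod_right_ae
  filter_upwards [h, hf.1.prodMk_left] with t h1 h2
  exact (memLp_two_iff_integrable_sq_norm h2).2 h1

theorem abs_inner_le_norm_sq_add (a b : E) : ‖inner ℝ a b‖ ≤ ‖a‖ ^ 2 + ‖b‖ ^ 2 := by
  have := norm_inner_le_norm (𝕜 := ℝ) a b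
  nlinarith [sq_nonneg (‖a‖ - ‖b‖), norm_nonneg a, norm_nonneg b]

theorem interval_inner_eq_translate [MeasurableSpace X] (μ : Measure X) (f g : ℝ × X → E)
    {δ : ℝ} (hδ : 0 ≤ δ) (t : ℝ) :
    ∫ r in (t - δ)..t, ∫ x, inner ℝ (f (r, x)) (g (t, x)) ∂μ
      = ∫ u in Ioc 0 δ, ∫ x, inner ℝ (f (t - u, x)) (g (t, x)) ∂μ := by
  rw [← intervalIntegral.integral_of_le hδ,
    intervalIntegral.integral_comp_sub_left
      (fun r => ∫ x, inner ℝ (f (r, x)) (g (t, x)) ∂μ) t, sub_zero]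

variable [MetricSpace X] [ProperSpace X] [MeasurableSpace X] [BorelSpace X]
  {μ : Measure X} [IsFiniteMeasure μ]

theorem measurePreserving_sub_fst (μ : Measure X) [IsFiniteMeasure μ] (u : ℝ) :
    MeasurePreserving (fun z : ℝ × X => (z.1 - u, z.2)) (volume.prod μ) (volume.prod μ) :=
  (measurePreserving_sub_right volume u).prod (MeasurePreserving.id μ)

/-- Strong continuity of translations in `L²`; this is what identifies the limit `δ → 0` in the
energy argument. -/
theorem continuous_integral_inner_translate {f g : ℝ × X → E}
    (hf : MemLp f 2 (volume.prod μ)) (hg : MemLp g 2 (volume.prod μ)) :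
    Continuous fun u : ℝ => ∫ z, inner ℝ (f (z.1 - u, z.2)) (g z) ∂(volume.prod μ) := by
  let s : ℝ → C(ℝ × X, ℝ × X) := fun u => ⟨fun z => (z.1 - u, z.2), by fun_prop⟩
  have hs : Continuous s :=
    (ContinuousMap.mk (fun a : ℝ × ℝ × X => (a.2.1 - a.1, a.2.2)) (by fun_prop)).curry.continuous
  have key : Continuous fun u : ℝ => inner ℝ
      (Lp.compMeasurePreserving (s u) (measurePreserving_sub_fst μ u) (hf.toLp f)) (hg.toLp g) :=
    (continuous_const.compMeasurePreservingLp hs (fun u => measurePreserving_sub_fst μ u)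
      (by norm_num)).inner continuous_const
  refine key.congr fun u => ?_
  rw [L2.inner_def]
  refine integral_congr_ae ?_
  filter_upwards [Lp.coeFn_compMeasurePreserving (hf.toLp f) (measurePreserving_sub_fst μ u),
    hg.coeFn_toLp,
    (measurePreserving_sub_fst μ u).quasiMeasurePreserving.ae_eq_comp hf.coeFn_toLp] with z h1 h2 h3
  have h1' : (Lp.compMeasurePreserving (s u) (measurePreserving_sub_fst μ u) (hf.toLp f)) z
    = f (z.1 - u, z.2) := h1.trans h3
  rw [h1', h2]

theorem integrable_inner_translate {f g : ℝ × X → E}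
    (hf : MemLp f 2 (volume.prod μ)) (hg : MemLp g 2 (volume.prod μ)) (δ : ℝ) :
    Integrable (fun y : ℝ × ℝ × X => inner ℝ (f (y.2.1 - y.1, y.2.2)) (g y.2))
      ((volume.restrict (Ioc 0 δ)).prod (volume.prod μ)) := by
  have hq : Measure.QuasiMeasurePreserving (fun y : ℝ × ℝ × X => (y.2.1 - y.1, y.2.2))
      ((volume.restrict (Ioc 0 δ)).prod (volume.prod μ)) (volume.prod μ) :=
    QuasiMeasurePreserving.prod_of_right (by fun_prop)
      (.of_forall fun u => (measurePreserving_sub_fst μ u).quasiMeasurePreserving)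
  have hm : AEStronglyMeasurable
      (fun y : ℝ × ℝ × X => inner ℝ (f (y.2.1 - y.1, y.2.2)) (g y.2))
      ((volume.restrict (Ioc 0 δ)).prod (volume.prod μ)) :=
    (hf.1.comp_quasiMeasurePreserving hq).inner hg.1.comp_snd
  have hfu : ∀ u : ℝ, MemLp (fun z : ℝ × X => f (z.1 - u, z.2)) 2 (volume.prod μ) := fun u =>
    hf.comp_measurePreserving (measurePreserving_sub_fst μ u)
  refine (integrable_prod_iff hm).2 ⟨.of_forall fun u => (hfu u).integrable_inner_two hg, ?_⟩
  -- Translation invariance makes the bound `‖f‖² + ‖g‖²` independent of the shift `u`, and the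
  -- shifts range over a set of finite measure.
  refine Integrable.of_bound hm.norm.integral_prod_right'
    ((∫ z, ‖f z‖ ^ 2 ∂(volume.prod μ)) + ∫ z, ‖g z‖ ^ 2 ∂(volume.prod μ))
    (.of_forall fun u => ?_)
  rw [Real.norm_of_nonneg (integral_nonneg fun _ => norm_nonneg _)]
  have h1 : ∫ z, ‖f z‖ ^ 2 ∂(volume.prod μ)
      = ∫ z : ℝ × X, ‖f (z.1 - u, z.2)‖ ^ 2 ∂(volume.prod μ) :=
    ((measurePreserving_sub_fst μ u).integral_comp
      (((MeasurableEquiv.subRight u).prodCongr (MeasurableEquiv.refl X)).measurableEmbedding)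
      (fun z => ‖f z‖ ^ 2)).symm
  rw [h1, ← integral_add (hfu u).integrable_norm_sq hg.integrable_norm_sq]
  exact integral_mono ((hfu u).integrable_inner_two hg).norm
    ((hfu u).integrable_norm_sq.add hg.integrable_norm_sq)
    fun z => abs_inner_le_norm_sq_add _ _

theorem integrable_integral_inner_translate {f g : ℝ × X → E}
    (hf : MemLp f 2 (volume.prod μ)) (hg : MemLp g 2 (volume.prod μ)) (δ : ℝ) :
    Integrable (fun y : ℝ × ℝ => ∫ x, inner ℝ (f (y.2 - y.1, x)) (g (y.2, x)) ∂μ)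
      ((volume.restrict (Ioc 0 δ)).prod volume) :=
  ((measurePreserving_prodAssoc (volume.restrict (Ioc 0 δ)) volume μ).integrable_comp_of_integrable
    (integrable_inner_translate hf hg δ)).integral_prod_left

theorem integrable_interval_inner {f g : ℝ × X → E}
    (hf : MemLp f 2 (volume.prod μ)) (hg : MemLp g 2 (volume.prod μ)) {δ : ℝ} (hδ : 0 ≤ δ) :
    Integrable fun t : ℝ => ∫ r in (t - δ)..t, ∫ x, inner ℝ (f (r, x)) (g (t, x)) ∂μ := by
  simp_rw [interval_inner_eq_translate μ f g hδ]
  exact (integrable_integral_inner_translate hf hg δ).integral_prod_right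

/-- Substituting `r = t - u` and exchanging the integrals turns an average over time windows into an
average over delays. -/
theorem integral_interval_inner {f g : ℝ × X → E}
    (hf : MemLp f 2 (volume.prod μ)) (hg : MemLp g 2 (volume.prod μ)) {δ : ℝ} (hδ : 0 ≤ δ) :
    ∫ t : ℝ, ∫ r in (t - δ)..t, ∫ x, inner ℝ (f (r, x)) (g (t, x)) ∂μ
      = ∫ u in (0 : ℝ)..δ, ∫ z, inner ℝ (f (z.1 - u, z.2)) (g z) ∂(volume.prod μ) := by
  simp_rw [interval_inner_eq_translate μ f g hδ, intervalIntegral.integral_of_le hδ]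
  rw [← integral_integral_swap (integrable_integral_inner_translate hf hg δ)]
  refine integral_congr_ae (.of_forall fun u => ?_)
  exact (integral_prod _ ((hf.comp_measurePreserving
    (measurePreserving_sub_fst μ u)).integrable_inner_two hg)).symm

end Pairing

/-! ### Energy inequality for an abstract weak evolution equation. -/

section Energy

variable {X E E' : Type*} [NormedAddCommGroup E] [InnerProductSpace ℝ E]
  [NormedAddCommGroup E'] [InnerProductSpace ℝ E'] [MeasurableSpace X]

theorem memLp_uncurry_indicator {E : Type*} [NormedAddCommGroup E] {μ : Measure X} [SFinite μ]
    {I : Set ℝ} (hI : MeasurableSet I) {f : ℝ → X → E}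
    (hf : MemLp (Function.uncurry f) 2 ((volume.restrict I).prod μ)) :
    MemLp (Function.uncurry (I.indicator f)) 2 (volume.prod μ) := by
  have h1 : Function.uncurry (I.indicator f) = (I ×ˢ univ).indicator (Function.uncurry f) := by
    ext ⟨t, x⟩
    by_cases ht : t ∈ I <;> simp [Function.uncurry, ht]
  rw [h1, memLp_indicator_iff_restrict (hI.prod MeasurableSet.univ), ← Measure.prod_restrict,
    Measure.restrict_univ]
  exact hf

theorem integrableOn_integral_inner {μ : Measure X} [SFinite μ]
    {I : Set ℝ} [IsFiniteMeasure (volume.restrict I)] {f : ℝ → X → E}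
    (hf : MemLp (Function.uncurry f) 2 ((volume.restrict I).prod μ)) {φ : X → E}
    (hφ : MemLp φ 2 μ) : IntegrableOn (fun s => ∫ x, inner ℝ (f s x) (φ x) ∂μ) I := by
  have h : MemLp (fun z : ℝ × X => φ z.2) 2 ((volume.restrict I).prod μ) := hφ.comp_snd _
  exact (hf.integrable_inner_two h).integral_prod_left

/-- The discarded term is `‖a - b‖²`. Only the later value `b` serves as test function. -/
theorem norm_sq_sub_norm_sq_le {μ : Measure X} {a b : X → E} (ha : MemLp a 2 μ)
    (hb : MemLp b 2 μ) : (∫ x, ‖b x‖ ^ 2 ∂μ) - ∫ x, ‖a x‖ ^ 2 ∂μ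
      ≤ 2 * ((∫ x, inner ℝ (b x) (b x) ∂μ) - ∫ x, inner ℝ (a x) (b x) ∂μ) := by
  rw [← integral_sub hb.integrable_norm_sq ha.integrable_norm_sq,
    ← integral_sub (hb.integrable_inner_two hb) (ha.integrable_inner_two hb),
    ← integral_const_mul]
  refine integral_mono (hb.integrable_norm_sq.sub ha.integrable_norm_sq)
    (((hb.integrable_inner_two hb).sub (ha.integrable_inner_two hb)).const_mul 2) fun x => ?_
  have := norm_sub_sq_real (a x) (b x)
  have h2 := sq_nonneg ‖a x - b x‖
  simp only [real_inner_self_eq_norm_sq]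
  linarith

theorem integral_norm_sub_sq {μ : Measure X} {a b : X → E} (ha : MemLp a 2 μ)
    (hb : MemLp b 2 μ) : ∫ x, ‖a x - b x‖ ^ 2 ∂μ
      = (∫ x, ‖a x‖ ^ 2 ∂μ) - 2 * (∫ x, inner ℝ (a x) (b x) ∂μ) + ∫ x, ‖b x‖ ^ 2 ∂μ := by
  rw [← integral_const_mul,
    ← integral_sub ha.integrable_norm_sq ((ha.integrable_inner_two hb).const_mul 2),
    ← integral_add (by exact ha.integrable_norm_sq.sub ((ha.integrable_inner_two hb).const_mul 2))
      hb.integrable_norm_sq]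
  exact integral_congr_ae (.of_forall fun x => norm_sub_sq_real (a x) (b x))

theorem interval_integral_indicator_Ioc {T t δ : ℝ} (hδ : 0 ≤ δ) (ht : t ∈ Icc 0 T) (b : ℝ → ℝ) :
    ∫ r in (t - δ)..t, (Ioc 0 T).indicator b r = ∫ r in (max (t - δ) 0)..t, b r := by
  rw [intervalIntegral.integral_of_le (by linarith), setIntegral_indicator measurableSet_Ioc,
    Ioc_inter_Ioc, min_eq_left ht.2, intervalIntegral.integral_of_le (max_le (by linarith) ht.1)]

theorem interval_integral_inner_indicator {μ : Measure X} {T : ℝ} (f g : ℝ → X → E) {δ t : ℝ}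
    (hδ : 0 ≤ δ) (ht : t ∈ Ioc 0 T) :
    ∫ r in (t - δ)..t, ∫ x, inner ℝ (Function.uncurry ((Ioc 0 T).indicator f) (r, x))
        (Function.uncurry ((Ioc 0 T).indicator g) (t, x)) ∂μ
      = ∫ r in (max (t - δ) 0)..t, ∫ x, inner ℝ (f r x) (g t x) ∂μ := by
  rw [← interval_integral_indicator_Ioc hδ (Ioc_subset_Icc_self ht)]
  congr 1
  ext r
  by_cases hr : r ∈ Ioc 0 T
  · rw [indicator_of_mem hr]
    simp only [Function.uncurry, indicator_of_mem hr, indicator_of_mem ht]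
  · rw [indicator_of_notMem hr]
    simp only [Function.uncurry, indicator_of_notMem hr, Pi.zero_apply, inner_zero_left,
      integral_zero]

theorem integral_inner_indicator {μ : Measure X} [SFinite μ] {I : Set ℝ} (hI : MeasurableSet I)
    {f g : ℝ → X → E} (hf : MemLp (Function.uncurry f) 2 ((volume.restrict I).prod μ))
    (hg : MemLp (Function.uncurry g) 2 ((volume.restrict I).prod μ)) :
    ∫ z : ℝ × X, inner ℝ (Function.uncurry (I.indicator f) (z.1, z.2))
        (Function.uncurry (I.indicator g) z) ∂(volume.prod μ)
      = ∫ t in I, ∫ x, inner ℝ (f t x) (g t x) ∂μ := by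
  rw [integral_prod _ ((memLp_uncurry_indicator hI hf).integrable_inner_two
    (memLp_uncurry_indicator hI hg)), ← integral_indicator hI]
  congr 1
  ext t
  by_cases ht : t ∈ I <;> simp [Function.uncurry, ht]

/-- The delayed function equals `n 0` on `[0, δ]` and a shift of `n` afterwards, so everything
cancels except the two layers of width `δ`. -/
theorem integral_sub_integral_delayed {T δ : ℝ} (hδ : 0 ≤ δ) (hδT : δ ≤ T) {n : ℝ → ℝ}
    (hn : IntervalIntegrable n volume 0 T) :
    IntervalIntegrable (fun t => n (max (t - δ) 0)) volume 0 T ∧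
    (∫ t in (0 : ℝ)..T, n t) - ∫ t in (0 : ℝ)..T, n (max (t - δ) 0)
      = (∫ t in (T - δ)..T, n t) - δ * n 0 := by
  have hn1 : IntervalIntegrable n volume 0 (T - δ) := hn.mono_set (by
    rw [uIcc_of_le (by linarith), uIcc_of_le (by linarith)]
    exact Icc_subset_Icc_right (by linarith))
  have hn2 : IntervalIntegrable n volume (T - δ) T := hn.mono_set (by
    rw [uIcc_of_le (by linarith), uIcc_of_le (by linarith)]
    exact Icc_subset_Icc_left (by linarith))
  have e1 : EqOn (fun _ => n 0) (fun t => n (max (t - δ) 0)) (uIcc 0 δ) := fun t ht => by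
    rw [uIcc_of_le hδ] at ht
    simp [max_eq_right (sub_nonpos.2 ht.2)]
  have e2 : EqOn (fun t => n (t - δ)) (fun t => n (max (t - δ) 0)) (uIcc δ T) := fun t ht => by
    rw [uIcc_of_le hδT] at ht
    simp [max_eq_left (sub_nonneg.2 ht.1)]
  have h1 : IntervalIntegrable (fun t => n (max (t - δ) 0)) volume 0 δ :=
    (intervalIntegrable_const (c := n 0)).congr (fun t ht => e1 (uIoc_subset_uIcc ht))
  have h2 : IntervalIntegrable (fun t => n (max (t - δ) 0)) volume δ T := by
    have := hn1.comp_sub_right δ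
    rw [zero_add, sub_add_cancel] at this
    exact this.congr (fun t ht => e2 (uIoc_subset_uIcc ht))
  refine ⟨h1.trans h2, ?_⟩
  rw [← intervalIntegral.integral_add_adjacent_intervals h1 h2,
    ← intervalIntegral.integral_congr e1, ← intervalIntegral.integral_congr e2,
    intervalIntegral.integral_comp_sub_right, sub_self, intervalIntegral.integral_const,
    ← intervalIntegral.integral_add_adjacent_intervals hn1 hn2]
  simp only [sub_zero, smul_eq_mul]
  ring

theorem nonneg_of_hasDerivAt_zero {K : ℝ → ℝ} {d T : ℝ} (hT : 0 < T) (hK : HasDerivAt K d 0)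
    (h0 : K 0 = 0) (hpos : ∀ δ ∈ Ioo 0 T, 0 ≤ K δ) : 0 ≤ d := by
  have h := (hasDerivAt_iff_tendsto_slope_zero.1 hK).mono_left
    (nhdsWithin_mono 0 (fun x (hx : x ∈ Ioi (0 : ℝ)) => (ne_of_gt hx : x ≠ 0)))
  refine ge_of_tendsto h ?_
  filter_upwards [Ioo_mem_nhdsGT hT] with δ hδ
  have := hpos δ hδ
  have h2 := inv_nonneg.2 hδ.1.le
  simp only [zero_add, h0, sub_zero, smul_eq_mul]
  positivity

variable [MetricSpace X] [ProperSpace X] [BorelSpace X] {μ : Measure X} [IsFiniteMeasure μ]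

/-- One-sided energy identity: a weak solution of `c v' = F + div S`, tested with itself, satisfies
`c ‖v T‖² ≤ c ‖v 0‖² + 2 ∫ (F, v) - (S, D)`. The relation `V φ Dφ` says that `φ` is an admissible
test function with gradient `Dφ`. -/
theorem energy_inequality {T c : ℝ} (hT : 0 < T) (hc : 0 < c)
    {v F : ℝ → X → E} {D S : ℝ → X → E'} {V : (X → E) → (X → E') → Prop}
    (hv : MemLp (Function.uncurry v) 2 ((volume.restrict (Ioc 0 T)).prod μ))
    (hD : MemLp (Function.uncurry D) 2 ((volume.restrict (Ioc 0 T)).prod μ))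
    (hF : MemLp (Function.uncurry F) 2 ((volume.restrict (Ioc 0 T)).prod μ))
    (hS : MemLp (Function.uncurry S) 2 ((volume.restrict (Ioc 0 T)).prod μ))
    (hslice : ∀ t ∈ Icc 0 T, MemLp (v t) 2 μ)
    (hV : ∀ φ Dφ, V φ Dφ → MemLp φ 2 μ ∧ MemLp Dφ 2 μ)
    (hdense : ∀ w : X → E, MemLp w 2 μ → ∀ ε > 0, ∃ φ Dφ, V φ Dφ ∧ ∫ x, ‖w x - φ x‖ ^ 2 ∂μ ≤ ε)
    (hmem : ∀ᵐ t ∂(volume.restrict (Ioc 0 T)), V (v t) (D t))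
    (hweak : ∀ φ Dφ, V φ Dφ → ∀ t ∈ Icc 0 T,
      c * (∫ x, inner ℝ (v t x) (φ x) ∂μ) - c * (∫ x, inner ℝ (v 0 x) (φ x) ∂μ)
        = ∫ s in (0 : ℝ)..t, ((∫ x, inner ℝ (F s x) (φ x) ∂μ) - ∫ x, inner ℝ (S s x) (Dφ x) ∂μ)) :
    c * (∫ x, ‖v T x‖ ^ 2 ∂μ) ≤ c * (∫ x, ‖v 0 x‖ ^ 2 ∂μ)
      + 2 * ∫ t in (0 : ℝ)..T,
          ((∫ x, inner ℝ (F t x) (v t x) ∂μ) - ∫ x, inner ℝ (S t x) (D t x) ∂μ) := by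
  set I : Set ℝ := Ioc 0 T with hI
  have hIm : MeasurableSet I := measurableSet_Ioc
  have hv' := memLp_uncurry_indicator hIm hv
  have hD' := memLp_uncurry_indicator hIm hD
  have hF' := memLp_uncurry_indicator hIm hF
  have hS' := memLp_uncurry_indicator hIm hS
  have hb : ∀ φ Dφ, V φ Dφ → IntegrableOn (fun s => (∫ x, inner ℝ (F s x) (φ x) ∂μ)
      - ∫ x, inner ℝ (S s x) (Dφ x) ∂μ) I := fun φ Dφ h =>
    (integrableOn_integral_inner hF (hV φ Dφ h).1).sub
      (integrableOn_integral_inner hS (hV φ Dφ h).2)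
  have hii : ∀ {b : ℝ → ℝ}, IntegrableOn b I → ∀ s ∈ Icc 0 T, ∀ t ∈ Icc 0 T,
      IntervalIntegrable b volume s t := fun {b} h s hs t ht =>
    ((intervalIntegrable_iff_integrableOn_Ioc_of_le hT.le).2 h).mono_set
      (by rw [uIcc_of_le hT.le]; exact uIcc_subset_Icc hs ht)
  set N : ℝ → ℝ := fun t => ∫ x, ‖v t x‖ ^ 2 ∂μ
  have hNI : IntegrableOn N I := hv.integrable_norm_sq.integral_prod_left
  -- Work over the window `[t - δ, t]` against the state frozen at `t`. Extension by zero lets the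
  -- window start before time `0`.
  set P : ℝ → ℝ → ℝ := fun δ t =>
    (∫ r in (t - δ)..t, ∫ x, inner ℝ (Function.uncurry (I.indicator F) (r, x))
      (Function.uncurry (I.indicator v) (t, x)) ∂μ)
    - ∫ r in (t - δ)..t, ∫ x, inner ℝ (Function.uncurry (I.indicator S) (r, x))
      (Function.uncurry (I.indicator D) (t, x)) ∂μ with hP
  set Φ : ℝ → ℝ := fun u =>
    (∫ z, inner ℝ (Function.uncurry (I.indicator F) (z.1 - u, z.2))
      (Function.uncurry (I.indicator v) z) ∂(volume.prod μ))
    - ∫ z, inner ℝ (Function.uncurry (I.indicator S) (z.1 - u, z.2))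
      (Function.uncurry (I.indicator D) z) ∂(volume.prod μ) with hΦ
  have hΦc : Continuous Φ := (continuous_integral_inner_translate hF' hv').sub
    (continuous_integral_inner_translate hS' hD')
  have hPint : ∀ δ, 0 ≤ δ → Integrable (P δ) := fun δ hδ =>
    (integrable_interval_inner hF' hv' hδ).sub (integrable_interval_inner hS' hD' hδ)
  have hPΦ : ∀ δ, 0 ≤ δ → ∫ t in I, P δ t = ∫ u in (0 : ℝ)..δ, Φ u := fun δ hδ => by
    have h0 : ∀ t ∉ I, P δ t = 0 := fun t ht => by simp [hP, ht]
    rw [setIntegral_eq_integral_of_forall_compl_eq_zero h0, hP,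
      integral_sub (integrable_interval_inner hF' hv' hδ) (integrable_interval_inner hS' hD' hδ),
      integral_interval_inner hF' hv' hδ, integral_interval_inner hS' hD' hδ,
      intervalIntegral.integral_sub
        ((continuous_integral_inner_translate hF' hv').intervalIntegrable _ _)
        ((continuous_integral_inner_translate hS' hD').intervalIntegrable _ _)]
  -- For almost every `t` the slice `v t` is admissible, so the weak equation at `t` and at the
  -- clamped time `max (t - δ) 0` can both be tested with it and subtracted.
  have hstep : ∀ δ ∈ Ioo 0 T, ∀ᵐ t ∂(volume.restrict I),
      c * N t - c * N (max (t - δ) 0) ≤ 2 * P δ t := by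
    intro δ hδ
    filter_upwards [hmem, ae_restrict_mem hIm] with t hVt ht
    have ht' : t ∈ Icc 0 T := Ioc_subset_Icc_self ht
    have ha : max (t - δ) 0 ∈ Icc 0 T :=
      ⟨le_max_right _ _, max_le (by linarith [ht.2, hδ.1]) hT.le⟩
    have h1 := mul_le_mul_of_nonneg_left (norm_sq_sub_norm_sq_le (hslice _ ha) (hslice t ht')) hc.le
    have h2 := hweak _ _ hVt t ht'
    have h3 := hweak _ _ hVt _ ha
    have h0T : (0 : ℝ) ∈ Icc 0 T := ⟨le_rfl, hT.le⟩
    have hbt := hb _ _ hVt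
    have h4 := intervalIntegral.integral_interval_sub_left (hii hbt 0 h0T t ht')
      (hii hbt 0 h0T _ ha)
    have h5 : P δ t = ∫ s in (max (t - δ) 0)..t, ((∫ x, inner ℝ (F s x) (v t x) ∂μ)
        - ∫ x, inner ℝ (S s x) (D t x) ∂μ) := by
      simp only [hP]
      rw [interval_integral_inner_indicator F v hδ.1.le ht,
        interval_integral_inner_indicator S D hδ.1.le ht, intervalIntegral.integral_sub
        (hii (integrableOn_integral_inner hF (hV _ _ hVt).1) _ ha _ ht')
        (hii (integrableOn_integral_inner hS (hV _ _ hVt).2) _ ha _ ht')]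
    rw [h5, ← h4, ← h2, ← h3]
    linarith
  have hmain : ∀ δ ∈ Ioo 0 T, c * (∫ t in (T - δ)..T, N t) - c * (δ * N 0)
      ≤ 2 * ∫ u in (0 : ℝ)..δ, Φ u := by
    intro δ hδ
    have hNii : IntervalIntegrable N volume 0 T :=
      (intervalIntegrable_iff_integrableOn_Ioc_of_le hT.le).2 hNI
    obtain ⟨g1, g2⟩ := integral_sub_integral_delayed hδ.1.le hδ.2.le hNii
    have g1' := (intervalIntegrable_iff_integrableOn_Ioc_of_le hT.le).1 g1
    have := integral_mono_ae ((hNI.const_mul c).sub (g1'.const_mul c))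
      ((hPint δ hδ.1.le).integrableOn.const_mul 2) (hstep δ hδ)
    simp only [Pi.sub_apply] at this
    rw [integral_sub (hNI.const_mul c) (g1'.const_mul c), integral_const_mul, integral_const_mul,
      integral_const_mul, hPΦ δ hδ.1.le, ← intervalIntegral.integral_of_le hT.le,
      ← intervalIntegral.integral_of_le hT.le] at this
    have g3 := congrArg (c * ·) g2
    simp only [mul_sub] at g3
    linarith
  have hΦ0 : Φ 0 = ∫ t in (0 : ℝ)..T,
      ((∫ x, inner ℝ (F t x) (v t x) ∂μ) - ∫ x, inner ℝ (S t x) (D t x) ∂μ) := by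
    simp only [hΦ]
    simp only [sub_zero]
    rw [integral_inner_indicator hIm hF hv, integral_inner_indicator hIm hS hD,
      intervalIntegral.integral_of_le hT.le, integral_sub]
    · exact (hF.integrable_inner_two hv).integral_prod_left
    · exact (hS.integrable_inner_two hD).integral_prod_left
  have hTm : T ∈ Icc 0 T := ⟨hT.le, le_rfl⟩
  -- `N` need not be continuous at `T`, and `v T` need not be admissible. Hence `N t` is bounded
  -- below by `2 (v t, φ) - ‖φ‖²`, which is continuous in `t` for admissible `φ`.
  have hlimit : ∀ φ Dφ, V φ Dφ → 2 * (c * ∫ x, inner ℝ (v T x) (φ x) ∂μ)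
      - c * (∫ x, ‖φ x‖ ^ 2 ∂μ) ≤ c * N 0 + 2 * Φ 0 := by
    intro φ Dφ hφ
    set b : ℝ → ℝ := fun s => (∫ x, inner ℝ (F s x) (φ x) ∂μ) - ∫ x, inner ℝ (S s x) (Dφ x) ∂μ
    set Q : ℝ → ℝ := fun t => c * (∫ x, inner ℝ (v 0 x) (φ x) ∂μ)
      + ∫ s in (0 : ℝ)..t, I.indicator b s with hQ
    have hbi : Integrable (I.indicator b) := (integrable_indicator_iff hIm).2 (hb φ Dφ hφ)
    have hQc : Continuous Q := continuous_const.add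
      (intervalIntegral.continuous_primitive (fun _ _ => hbi.intervalIntegrable) 0)
    have hQv : ∀ t ∈ Icc 0 T, Q t = c * ∫ x, inner ℝ (v t x) (φ x) ∂μ := by
      intro t ht
      have h1 := hweak φ Dφ hφ t ht
      have h2 := interval_integral_indicator_Ioc ht.1 ht b
      rw [sub_self, max_self] at h2
      simp only [hQ]
      rw [h2, ← h1]
      ring
    set M := ∫ x, ‖φ x‖ ^ 2 ∂μ
    have hQN : ∀ t ∈ Icc 0 T, 2 * Q t - c * M ≤ c * N t := by
      intro t ht
      have h := integral_norm_sub_sq (hslice t ht) (hV φ Dφ hφ).1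
      have h2 : 0 ≤ ∫ x, ‖v t x - φ x‖ ^ 2 ∂μ := integral_nonneg fun x => sq_nonneg _
      rw [h] at h2
      rw [hQv t ht]
      have := mul_nonneg hc.le h2
      linarith
    -- `K δ ≥ 0` is `hmain` with `c * N` replaced by its minorant `2 * Q - c * M`. As `K 0 = 0`, the
    -- derivative at `0` is nonnegative, which is the claim.
    let K : ℝ → ℝ := fun δ => 2 * (∫ u in (0 : ℝ)..δ, Φ u) + δ * (c * N 0 + c * M)
      + 2 * ∫ t in T..(T - δ), Q t
    have hK0 : K 0 = 0 := by simp [K]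
    have hKd : HasDerivAt K (2 * Φ 0 + 1 * (c * N 0 + c * M) + 2 * (Q T * (-1))) 0 := by
      refine ((hΦc.integral_hasStrictDerivAt 0 0).hasDerivAt.const_mul 2).add
        ((hasDerivAt_id 0).mul_const _) |>.add (HasDerivAt.const_mul 2 ?_)
      have h1 := (hQc.integral_hasStrictDerivAt T (T - 0)).hasDerivAt
      have h2 := h1.comp (0 : ℝ) ((hasDerivAt_id (0 : ℝ)).const_sub T)
      simpa only [sub_zero, Function.comp_def] using h2
    have hKpos : ∀ δ ∈ Ioo 0 T, 0 ≤ K δ := by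
      intro δ hδ
      have hTδ : T - δ ∈ Icc 0 T := ⟨by linarith [hδ.2], by linarith [hδ.1]⟩
      have h1 := hmain δ hδ
      have h2 : ∫ t in (T - δ)..T, (2 * Q t - c * M) ≤ ∫ t in (T - δ)..T, c * N t := by
        refine intervalIntegral.integral_mono_on hTδ.2
          (((hQc.const_mul 2).sub continuous_const).intervalIntegrable _ _)
          ((hii hNI _ hTδ _ hTm).const_mul c) fun t ht => hQN t ⟨hTδ.1.trans ht.1, ht.2⟩
      rw [intervalIntegral.integral_sub (by exact (hQc.const_mul 2).intervalIntegrable _ _)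
        intervalIntegrable_const, intervalIntegral.integral_const_mul,
        intervalIntegral.integral_const, intervalIntegral.integral_const_mul, smul_eq_mul] at h2
      have h3 : ∫ t in T..(T - δ), Q t = -∫ t in (T - δ)..T, Q t :=
        intervalIntegral.integral_symm _ _
      simp only [K]
      rw [h3]
      linarith
    have := nonneg_of_hasDerivAt_zero hT hKd hK0 hKpos
    rw [hQv T hTm] at this
    linarith
  rw [← hΦ0]
  -- For `φ` close to `v T` in `L²`, the minorant `2 (v T, φ) - ‖φ‖²` is within `ε / c` of `‖v T‖²`.
  refine le_of_forall_pos_le_add fun ε hε => ?_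
  obtain ⟨φ, Dφ, hφ, hle⟩ := hdense (v T) (hslice T hTm) (ε / c) (by positivity)
  have h1 := hlimit φ Dφ hφ
  rw [integral_norm_sub_sq (hslice T hTm) (hV φ Dφ hφ).1] at hle
  have h2 := mul_le_mul_of_nonneg_left hle hc.le
  rw [mul_div_cancel₀ _ hc.ne'] at h2
  simp only [mul_add, mul_sub] at h2
  linarith

end Energy

/-! ### Passage to the limit in `L²` norms and pairings. -/

section Limits

variable {α E : Type*} [MeasurableSpace α] {μ : Measure α}

theorem MeasureTheory.MemLp.norm_toLp_sq [NormedAddCommGroup E] {f : α → E} (hf : MemLp f 2 μ) :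
    ‖hf.toLp f‖ ^ 2 = ∫ x, ‖f x‖ ^ 2 ∂μ := by
  rw [Lp.norm_toLp, hf.eLpNorm_eq_integral_rpow_norm (by norm_num) (by norm_num)]
  have h : 0 ≤ ∫ x, ‖f x‖ ^ 2 ∂μ := integral_nonneg fun x => sq_nonneg _
  simp only [ENNReal.toReal_ofNat, Real.rpow_ofNat]
  rw [ENNReal.toReal_ofReal (by positivity), ← Real.rpow_natCast, ← Real.rpow_mul h]
  norm_num

theorem tendsto_integral_norm_sq [NormedAddCommGroup E] {f : ℕ → α → E} {g : α → E}
    (hf : ∀ n, MemLp (f n) 2 μ) (hg : MemLp g 2 μ)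
    (h : Tendsto (fun n => eLpNorm (f n - g) 2 μ) atTop (𝓝 0)) :
    Tendsto (fun n => ∫ x, ‖f n x‖ ^ 2 ∂μ) atTop (𝓝 (∫ x, ‖g x‖ ^ 2 ∂μ)) := by
  simpa only [MemLp.norm_toLp_sq] using
    ((Lp.tendsto_Lp_iff_tendsto_eLpNorm'' f hf g hg).2 h).norm.pow 2

variable [NormedAddCommGroup E] [InnerProductSpace ℝ E]

theorem inner_toLp {f g : α → E} (hf : MemLp f 2 μ) (hg : MemLp g 2 μ) :
    inner ℝ (hf.toLp f) (hg.toLp g) = ∫ x, inner ℝ (f x) (g x) ∂μ := by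
  rw [L2.inner_def]
  refine integral_congr_ae ?_
  filter_upwards [hf.coeFn_toLp, hg.coeFn_toLp] with x h1 h2
  rw [h1, h2]

theorem tendsto_integral_inner {f : ℕ → α → E} {g : α → E}
    (hf : ∀ n, MemLp (f n) 2 μ) (hg : MemLp g 2 μ)
    (h : Tendsto (fun n => eLpNorm (f n - g) 2 μ) atTop (𝓝 0)) {w : α → E} (hw : MemLp w 2 μ) :
    Tendsto (fun n => ∫ x, inner ℝ (f n x) (w x) ∂μ) atTop (𝓝 (∫ x, inner ℝ (g x) (w x) ∂μ)) := by
  simpa only [inner_toLp] using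
    ((Lp.tendsto_Lp_iff_tendsto_eLpNorm'' f hf g hg).2 h).inner (𝕜 := ℝ)
      (tendsto_const_nhds (x := hw.toLp w))

end Limits

/-! ### Density of test functions and integration by parts. -/

section TestFunctions

variable {E : Type*} [NormedAddCommGroup E] [NormedSpace ℝ E] [FiniteDimensional ℝ E]
  [MeasurableSpace E] [BorelSpace E]

/-- Smooth functions compactly supported in an open set `U` are dense in `L²(U)`. -/
theorem exists_contDiff_tsupport_subset_integral_sq_le {F : Type*} [NormedAddCommGroup F]
    [InnerProductSpace ℝ F] [CompleteSpace F] {μ : Measure E} {U : Set E} (hU : IsOpen U)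
    [IsFiniteMeasure (μ.restrict U)] {w : E → F} (hw : MemLp w 2 (μ.restrict U))
    {ε : ℝ} (hε : 0 < ε) :
    ∃ φ : E → F, ContDiff ℝ ∞ φ ∧ HasCompactSupport φ ∧ tsupport φ ⊆ U ∧
      ∫ x in U, ‖w x - φ x‖ ^ 2 ∂μ ≤ ε := by
  have hmem : ∀ φ : E → F, ContDiff ℝ ∞ φ → HasCompactSupport φ → MemLp φ 2 (μ.restrict U) :=
    fun φ h1 h2 => h1.continuous.memLp_of_hasCompactSupport h2
  let K : Submodule ℝ (Lp F 2 (μ.restrict U)) :=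
    { carrier := {f | ∃ φ : E → F, ContDiff ℝ ∞ φ ∧ HasCompactSupport φ ∧ tsupport φ ⊆ U ∧
        f =ᵐ[μ.restrict U] φ}
      add_mem' := by
        rintro f g ⟨φ, h1, h2, h3, h4⟩ ⟨ψ, g1, g2, g3, g4⟩
        exact ⟨φ + ψ, h1.add g1, h2.add g2, (tsupport_add φ ψ).trans (union_subset h3 g3),
          (Lp.coeFn_add f g).trans (h4.add g4)⟩
      zero_mem' := ⟨0, contDiff_const, HasCompactSupport.zero, by simp [tsupport], Lp.coeFn_zero ..⟩
      smul_mem' := by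
        rintro c f ⟨φ, h1, h2, h3, h4⟩
        refine ⟨c • φ, h1.const_smul c, h2.smul_left (f := fun _ => c), ?_,
          (Lp.coeFn_smul c f).trans (h4.const_smul c)⟩
        exact (closure_mono (Function.support_const_smul_subset c φ)).trans h3 }
  -- An `h` orthogonal to every `g • e`, with `g` a scalar test function and `e` a fixed vector,
  -- satisfies `∫ g • h = 0`, so it vanishes by the fundamental lemma of the calculus of variations.
  have hK : K.topologicalClosure = ⊤ := by
    rw [Submodule.topologicalClosure_eq_top_iff, Submodule.eq_bot_iff]
    intro h hh
    have hi : Integrable h (μ.restrict U) := (Lp.memLp h).integrable (by norm_num)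
    have hz := hU.ae_eq_zero_of_integral_contDiff_smul_eq_zero (f := h) (μ := μ.restrict U)
      (hi.locallyIntegrable.locallyIntegrableOn U) (fun g g1 g2 g3 => by
        have hgh : Integrable (fun x => g x • h x) (μ.restrict U) := by
          obtain ⟨C, hC⟩ := g1.continuous.bounded_above_of_compact_support g2
          exact hi.bdd_smul C g1.continuous.aestronglyMeasurable (.of_forall hC)
        refine ext_inner_left ℝ fun e => ?_
        rw [inner_zero_right, ← integral_inner hgh]
        have hφ := hmem (fun x => g x • e) (g1.smul contDiff_const) g2.smul_right
        have hin := hh (hφ.toLp _) ⟨fun x => g x • e, g1.smul contDiff_const, g2.smul_right,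
          (closure_mono (fun x hx => by
            simp only [Function.mem_support, ne_eq, smul_eq_zero, not_or] at hx ⊢
            exact hx.1)).trans g3, hφ.coeFn_toLp⟩
        rw [L2.inner_def] at hin
        rw [← hin]
        refine integral_congr_ae ?_
        filter_upwards [hφ.coeFn_toLp] with x hx
        rw [hx, inner_smul_left, inner_smul_right]
        rfl)
    rw [ae_restrict_iff' hU.measurableSet] at hz
    refine (Lp.eq_zero_iff_ae_eq_zero).2 ?_
    filter_upwards [(ae_restrict_iff' hU.measurableSet).2 hz, ae_restrict_mem hU.measurableSet]
      with x hx hxU using hx hxU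
  have hcl : hw.toLp w ∈ closure (K : Set (Lp F 2 (μ.restrict U))) := by
    rw [← Submodule.topologicalClosure_coe, hK]; trivial
  obtain ⟨f, ⟨φ, h1, h2, h3, h4⟩, hd⟩ := Metric.mem_closure_iff.1 hcl (√ε) (Real.sqrt_pos.2 hε)
  refine ⟨φ, h1, h2, h3, ?_⟩
  have hφ := hmem φ h1 h2
  have hf : f = hφ.toLp φ := Lp.ext (h4.trans hφ.coeFn_toLp.symm)
  rw [hf, dist_eq_norm, ← MemLp.toLp_sub] at hd
  have := (hw.sub hφ).norm_toLp_sq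
  simp only [Pi.sub_apply] at this
  rw [← this, ← Real.sq_sqrt hε.le]
  exact pow_le_pow_left₀ (norm_nonneg _) hd.le 2

variable {μ : Measure E} [μ.IsAddHaarMeasure]

theorem integral_fderiv_eq_zero_of_hasCompactSupport {a : E → ℝ} (ha : ContDiff ℝ 1 a)
    (hs : HasCompactSupport a) (u : E) : ∫ x, fderiv ℝ a x u ∂μ = 0 := by
  have hd : Continuous fun x => fderiv ℝ a x u :=
    (ha.continuous_fderiv one_ne_zero).clm_apply continuous_const
  have hc : HasCompactSupport fun x => fderiv ℝ a x u := hs.fderiv_apply ℝ u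
  have h := integral_mul_fderiv_eq_neg_fderiv_mul_of_integrable (μ := μ) (𝕜 := ℝ)
    (f := fun _ : E => (1 : ℝ)) (g := a) (v := u) (by simp)
    (by simpa using hd.integrable_of_hasCompactSupport hc)
    (by simpa using ha.continuous.integrable_of_hasCompactSupport hs)
    (fun x _ => differentiableAt_const _) (fun x _ => ha.differentiable one_ne_zero x)
  simpa using h

/-- Both sides equal minus the integral of `a` times the mixed second derivative of `b`, which is
symmetric. This makes `det ∇ψ` a null Lagrangian, the key to Korn's inequality. -/
theorem integral_fderiv_mul_fderiv_comm {a b : E → ℝ} (ha : ContDiff ℝ 1 a)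
    (hb : ContDiff ℝ 2 b) (hs : HasCompactSupport a) (u w : E) :
    ∫ x, fderiv ℝ a x u * fderiv ℝ b x w ∂μ = ∫ x, fderiv ℝ a x w * fderiv ℝ b x u ∂μ := by
  have hb' : ContDiff ℝ 1 (fderiv ℝ b) := hb.fderiv_right (by norm_num)
  have hbw : ∀ w, ContDiff ℝ 1 fun x => fderiv ℝ b x w := fun w => hb'.clm_apply contDiff_const
  have hda : ∀ u, Continuous fun x => fderiv ℝ a x u := fun u =>
    (ha.continuous_fderiv one_ne_zero).clm_apply continuous_const
  have hbw' : ∀ u w, Continuous fun x => fderiv ℝ (fun x => fderiv ℝ b x w) x u := fun u w =>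
    ((hbw w).continuous_fderiv one_ne_zero).clm_apply continuous_const
  have key : ∀ u w, ∫ x, a x * fderiv ℝ (fun x => fderiv ℝ b x w) x u ∂μ
      = -∫ x, fderiv ℝ a x u * fderiv ℝ b x w ∂μ := fun u w =>
    integral_mul_fderiv_eq_neg_fderiv_mul_of_integrable
      (((hda u).mul (hbw w).continuous).integrable_of_hasCompactSupport
        (hs.fderiv_apply ℝ u).mul_right)
      ((ha.continuous.mul (hbw' u w)).integrable_of_hasCompactSupport hs.mul_right)
      ((ha.continuous.mul (hbw w).continuous).integrable_of_hasCompactSupport hs.mul_right)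
      (fun x _ => ha.differentiable one_ne_zero x) (fun x _ => (hbw w).differentiable one_ne_zero x)
  have hsymm : ∀ x, fderiv ℝ (fun x => fderiv ℝ b x w) x u
      = fderiv ℝ (fun x => fderiv ℝ b x u) x w := fun x => by
    have hd := hb'.differentiable one_ne_zero x
    have := (hb.contDiffAt (x := x)).isSymmSndFDerivAt (by simp) u w
    rw [fderiv_clm_apply hd (differentiableAt_const _),
      fderiv_clm_apply hd (differentiableAt_const _)]
    simpa using this
  have h1 := key u w
  have h2 := key w u
  simp_rw [hsymm] at h1
  linarith

end TestFunctions

/-! ### Korn and Poincaré inequalities on `H¹₀`. -/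

namespace SeaIce

theorem norm_tensor_sq (G : Tensor) :
    ‖G‖ ^ 2 = G (0, 0) ^ 2 + G (0, 1) ^ 2 + G (1, 0) ^ 2 + G (1, 1) ^ 2 := by
  rw [EuclideanSpace.norm_sq_eq, Fintype.sum_prod_type]
  simp only [Fin.sum_univ_two, Real.norm_eq_abs, sq_abs]
  ring

/-- The last bracket is `-det G`, whose integral vanishes for the gradient of a test function. -/
theorem norm_sym_sq (G : Tensor) : ‖sym G‖ ^ 2 = 1 / 2 * ‖G‖ ^ 2 + 1 / 2 * tr G ^ 2
    + (G (0, 1) * G (1, 0) - G (0, 0) * G (1, 1)) := by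
  rw [norm_tensor_sq, norm_tensor_sq]
  simp only [sym, tr]
  ring

theorem inner_tensor (G H : Tensor) : inner ℝ G H = G (0, 0) * H (0, 0) + G (0, 1) * H (0, 1)
    + G (1, 0) * H (1, 0) + G (1, 1) * H (1, 1) := by
  rw [PiLp.inner_apply, Fintype.sum_prod_type]
  simp only [Fin.sum_univ_two, RCLike.inner_apply, conj_trivial]
  ring

theorem inner_idTensor (G : Tensor) : inner ℝ G idTensor = tr G := by
  simp [inner_tensor, idTensor, tr]

theorem norm_sym_le (G : Tensor) : ‖sym G‖ ≤ ‖G‖ := by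
  refine le_of_sq_le_sq ?_ (norm_nonneg _)
  rw [norm_tensor_sq, norm_tensor_sq]
  simp only [sym]
  nlinarith [sq_nonneg (G (0, 1) - G (1, 0))]

theorem sym_sub (G H : Tensor) : sym (G - H) = sym G - sym H := by
  ext i
  simp only [sym, PiLp.sub_apply]
  ring

theorem continuous_sym : Continuous sym := by
  unfold sym
  fun_prop

theorem continuous_tr : Continuous tr := by
  unfold tr
  fun_prop

theorem grad_apply (ψ : Plane → Plane) (hψ : Differentiable ℝ ψ) (x : Plane) (i j : Fin 2) :
    grad ψ x (i, j) = fderiv ℝ (fun y => ψ y i) x (EuclideanSpace.single j 1) := by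
  have h := ((EuclideanSpace.proj i : Plane →L[ℝ] ℝ).hasFDerivAt.comp x (hψ x).hasFDerivAt).fderiv
  have h' : fderiv ℝ (fun y => ψ y i) x
      = (EuclideanSpace.proj i : Plane →L[ℝ] ℝ).comp (fderiv ℝ ψ x) := h
  rw [h']
  rfl

theorem continuous_grad {ψ : Plane → Plane} (hψ : ContDiff ℝ 1 ψ) : Continuous (grad ψ) := by
  have := hψ.continuous_fderiv one_ne_zero
  unfold grad
  fun_prop

theorem hasCompactSupport_grad {ψ : Plane → Plane} (hψ : HasCompactSupport ψ) :
    HasCompactSupport (grad ψ) :=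
  (hψ.fderiv ℝ).comp_left (g := fun L : Plane →L[ℝ] Plane =>
    (WithLp.toLp 2 fun ij => (L (EuclideanSpace.single ij.2 1)) ij.1 : Tensor)) (by ext; simp)

theorem grad_eq_zero_of_notMem {ψ : Plane → Plane} {Ω : Set Plane} (hψ : tsupport ψ ⊆ Ω)
    {x : Plane} (hx : x ∉ Ω) : grad ψ x = 0 := by
  have : fderiv ℝ ψ x = 0 :=
    image_eq_zero_of_notMem_tsupport fun h => hx (hψ (tsupport_fderiv_subset ℝ h))
  ext
  simp [grad, this]

theorem norm_fderiv_le_norm_grad (ψ : Plane → Plane) (x : Plane) :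
    ‖fderiv ℝ ψ x‖ ≤ ‖grad ψ x‖ := by
  refine ContinuousLinearMap.opNorm_le_bound _ (norm_nonneg _) fun y => ?_
  have hy : y = y 0 • EuclideanSpace.single 0 1 + y 1 • EuclideanSpace.single 1 1 := by
    ext i
    fin_cases i <;> simp
  have hi : ∀ i, (fderiv ℝ ψ x y) i = y 0 * grad ψ x (i, 0) + y 1 * grad ψ x (i, 1) := fun i => by
    conv_lhs => rw [hy]
    simp [grad]
  refine le_of_sq_le_sq ?_ (by positivity)
  rw [mul_pow, norm_tensor_sq, EuclideanSpace.norm_sq_eq, EuclideanSpace.norm_sq_eq]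
  simp only [Fin.sum_univ_two, Real.norm_eq_abs, sq_abs, hi]
  nlinarith [sq_nonneg (y 0 * grad ψ x (0, 1) - y 1 * grad ψ x (0, 0)),
    sq_nonneg (y 0 * grad ψ x (1, 1) - y 1 * grad ψ x (1, 0))]

theorem memLp_smooth {ψ : Plane → Plane} (hψ : ContDiff ℝ ∞ ψ) (hs : HasCompactSupport ψ)
    (μ : Measure Plane) [IsFiniteMeasureOnCompacts μ] : MemLp ψ 2 μ :=
  hψ.continuous.memLp_of_hasCompactSupport hs

theorem memLp_grad_smooth {ψ : Plane → Plane} (hψ : ContDiff ℝ ∞ ψ) (hs : HasCompactSupport ψ)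
    (μ : Measure Plane) [IsFiniteMeasureOnCompacts μ] :
    MemLp (grad ψ) 2 μ :=
  (continuous_grad (hψ.of_le (by simp))).memLp_of_hasCompactSupport (hasCompactSupport_grad hs)

theorem integral_tr_grad {ψ : Plane → Plane} (hψ : ContDiff ℝ ∞ ψ)
    (hs : HasCompactSupport ψ) :
    ∫ x, tr (grad ψ x) = 0 := by
  have hd := hψ.differentiable (by simp)
  have hc : ∀ i, ContDiff ℝ 1 fun y => ψ y i := fun i =>
    (EuclideanSpace.proj i : Plane →L[ℝ] ℝ).contDiff.comp (hψ.of_le (by simp))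
  have hci : ∀ i, HasCompactSupport fun y => ψ y i := fun i =>
    hs.comp_left (g := fun z : Plane => z i) rfl
  have hint : ∀ i (u : Plane), Integrable fun x => fderiv ℝ (fun y => ψ y i) x u := fun i u =>
    (((hc i).continuous_fderiv one_ne_zero).clm_apply
      continuous_const).integrable_of_hasCompactSupport ((hci i).fderiv_apply ℝ u)
  simp only [tr, grad_apply ψ hd]
  rw [integral_add (hint _ _) (hint _ _),
    integral_fderiv_eq_zero_of_hasCompactSupport (hc _) (hci _),
    integral_fderiv_eq_zero_of_hasCompactSupport (hc _) (hci _), add_zero]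

theorem integral_norm_grad_sq_le {ψ : Plane → Plane} (hψ : ContDiff ℝ ∞ ψ)
    (hs : HasCompactSupport ψ) :
    1 / 2 * ∫ x, ‖grad ψ x‖ ^ 2 ≤ ∫ x, ‖sym (grad ψ x)‖ ^ 2 := by
  have hd := hψ.differentiable (by simp)
  have hc : ∀ i, ContDiff ℝ 2 fun y => ψ y i := fun i =>
    (EuclideanSpace.proj i : Plane →L[ℝ] ℝ).contDiff.comp (contDiff_infty.1 hψ 2)
  have hc1 : ∀ i, ContDiff ℝ 1 fun y => ψ y i := fun i => (hc i).of_le (by norm_num)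
  have hci : ∀ i, HasCompactSupport fun y => ψ y i := fun i =>
    hs.comp_left (g := fun z : Plane => z i) rfl
  have hcf : ∀ i (u : Plane), Continuous fun x => fderiv ℝ (fun y => ψ y i) x u := fun i u =>
    ((hc1 i).continuous_fderiv one_ne_zero).clm_apply continuous_const
  have hprod : ∀ (i j : Fin 2) (u w : Plane), Integrable fun x =>
      fderiv ℝ (fun y => ψ y i) x u * fderiv ℝ (fun y => ψ y j) x w := fun i j u w =>
    ((hcf i u).mul (hcf j w)).integrable_of_hasCompactSupport ((hci i).fderiv_apply ℝ u).mul_right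
  have hg := memLp_grad_smooth hψ hs volume
  have hgi := hg.integrable_norm_sq
  have htr : Integrable fun x => tr (grad ψ x) ^ 2 := by
    refine (hgi.const_mul 2).mono' ((continuous_tr.comp
      (continuous_grad (hψ.of_le (by simp)))).pow 2).aestronglyMeasurable (.of_forall fun x => ?_)
    rw [Real.norm_of_nonneg (sq_nonneg _), norm_tensor_sq]
    simp only [tr]
    nlinarith [sq_nonneg (grad ψ x (0, 0) - grad ψ x (1, 1)), sq_nonneg (grad ψ x (0, 1)),
      sq_nonneg (grad ψ x (1, 0))]
  have hdet : ∫ x, (grad ψ x (0, 1) * grad ψ x (1, 0) - grad ψ x (0, 0) * grad ψ x (1, 1)) = 0 := by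
    simp only [grad_apply ψ hd]
    rw [integral_sub (hprod _ _ _ _) (hprod _ _ _ _),
      integral_fderiv_mul_fderiv_comm (hc1 0) (hc 1) (hci 0), sub_self]
  have hdeti : Integrable fun x =>
      grad ψ x (0, 1) * grad ψ x (1, 0) - grad ψ x (0, 0) * grad ψ x (1, 1) := by
    simp only [grad_apply ψ hd]
    exact (hprod _ _ _ _).sub (hprod _ _ _ _)
  simp only [norm_sym_sq]
  rw [integral_add (by exact (hgi.const_mul _).add (htr.const_mul _)) hdeti, hdet,
    integral_add (hgi.const_mul _) (htr.const_mul _), integral_const_mul, integral_const_mul]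
  have : 0 ≤ ∫ x, tr (grad ψ x) ^ 2 := integral_nonneg fun x => sq_nonneg _
  linarith

section H10

variable {Ω : Set Plane} {φ : Plane → Plane} {Dφ : Plane → Tensor}

theorem memH10_of_contDiff {ψ : Plane → Plane} (hψ : ContDiff ℝ ∞ ψ) (hs : HasCompactSupport ψ)
    (hΩ : tsupport ψ ⊆ Ω) : MemH10 Ω ψ (grad ψ) where
  memLp := memLp_smooth hψ hs _
  memLp_grad := memLp_grad_smooth hψ hs _
  approx := ⟨fun _ => ψ, fun _ => ⟨hψ, hs, hΩ⟩, by simp, by simp⟩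

theorem memLp_sym {α : Type*} [MeasurableSpace α] {μ : Measure α} {G : α → Tensor}
    (hG : MemLp G 2 μ) : MemLp (fun x => sym (G x)) 2 μ :=
  hG.mono (continuous_sym.comp_aestronglyMeasurable hG.1) (.of_forall fun _ => norm_sym_le _)

/-- The trace is the pairing with `idTensor`, which lies in `L²` because `Ω` has finite measure; the
identity therefore survives the limit from test functions. It removes the pressure term. -/
theorem MemH10.integral_tr [IsFiniteMeasure (volume.restrict Ω)] (h : MemH10 Ω φ Dφ) :
    ∫ x in Ω, tr (Dφ x) = 0 := by
  obtain ⟨ψ, h1, -, h3⟩ := h.approx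
  have hlim := tendsto_integral_inner (fun n => memLp_grad_smooth (h1 n).1 (h1 n).2.1 _)
    h.memLp_grad h3 (memLp_const idTensor)
  simp only [inner_idTensor] at hlim
  refine tendsto_nhds_unique hlim ((tendsto_const_nhds (x := (0 : ℝ))).congr fun n => ?_)
  rw [setIntegral_eq_integral_of_forall_compl_eq_zero fun x hx => by
    rw [grad_eq_zero_of_notMem (h1 n).2.2 hx]; simp [tr], integral_tr_grad (h1 n).1 (h1 n).2.1]

theorem korn_half (Ω : Set Plane) : Korn Ω (1 / 2) := by
  intro φ Dφ h
  obtain ⟨ψ, h1, -, h3⟩ := h.approx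
  have hm := fun n => memLp_grad_smooth (h1 n).1 (h1 n).2.1 (volume.restrict Ω)
  have hlim := tendsto_integral_norm_sq hm h.memLp_grad h3
  have hlim' := tendsto_integral_norm_sq (fun n => memLp_sym (hm n)) (memLp_sym h.memLp_grad)
    (tendsto_of_tendsto_of_tendsto_of_le_of_le tendsto_const_nhds h3 (fun _ => zero_le)
      fun n => eLpNorm_mono fun x => by
        simp only [Pi.sub_apply, ← sym_sub]
        exact norm_sym_le _)
  refine le_of_tendsto_of_tendsto (hlim.const_mul (1 / 2)) hlim' (.of_forall fun n => ?_)
  simp only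
  have h0 : ∀ x ∉ Ω, grad (ψ n) x = 0 := fun x hx => grad_eq_zero_of_notMem (h1 n).2.2 hx
  rw [setIntegral_eq_integral_of_forall_compl_eq_zero fun x hx => by simp [h0 x hx],
    setIntegral_eq_integral_of_forall_compl_eq_zero fun x hx => by
      rw [h0 x hx, norm_sym_sq]; simp [tr]]
  exact integral_norm_grad_sq_le (h1 n).1 (h1 n).2.1

/-- In dimension two the Gagliardo–Nirenberg–Sobolev inequality bounds the `L²` norm by the `L¹`
norm of the gradient; Hölder on the finite measure of `Ω` then gives `L²`. -/
theorem exists_poincare_smooth (Ω : Set Plane) [IsFiniteMeasure (volume.restrict Ω)] :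
    ∃ C : ℝ, 0 ≤ C ∧ ∀ ψ : Plane → Plane, ContDiff ℝ ∞ ψ → HasCompactSupport ψ → tsupport ψ ⊆ Ω →
      normSq Ω ψ ≤ C * normSq Ω (grad ψ) := by
  set K := eLpNormLESNormFDerivOneConst (volume : Measure Plane) 2
  set m := (volume.restrict Ω) univ ^ (1 / (1 : ENNReal).toReal - 1 / (2 : ENNReal).toReal)
  have hm' : m ≠ ⊤ := ENNReal.rpow_ne_top_of_nonneg (by norm_num) (measure_ne_top _ _)
  refine ⟨((K : ℝ) * m.toReal) ^ 2, by positivity, fun ψ h1 h2 h3 => ?_⟩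
  have hψ := memLp_smooth h1 h2 (volume.restrict Ω)
  have hg := memLp_grad_smooth h1 h2 (volume.restrict Ω)
  have hgns : eLpNorm ψ 2 volume ≤ K * eLpNorm (fderiv ℝ ψ) 1 volume :=
    eLpNorm_le_eLpNorm_fderiv_one (p := 2) volume (h1.of_le (by simp)) h2 (by
      simp only [finrank_euclideanSpace, Fintype.card_fin]
      exact NNReal.HolderConjugate.two_two)
  have hsupp : eLpNorm (grad ψ) 1 volume = eLpNorm (grad ψ) 1 (volume.restrict Ω) :=
    (eLpNorm_restrict_eq_of_support_subset fun x hx => by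
      by_contra hxΩ
      exact hx (grad_eq_zero_of_notMem h3 hxΩ)).symm
  have hle : eLpNorm ψ 2 (volume.restrict Ω) ≤ K * (eLpNorm (grad ψ) 2 (volume.restrict Ω) * m) :=
    calc eLpNorm ψ 2 (volume.restrict Ω) ≤ eLpNorm ψ 2 volume :=
          eLpNorm_mono_measure _ Measure.restrict_le_self
      _ ≤ K * eLpNorm (grad ψ) 1 volume := hgns.trans (mul_le_mul_right
          (eLpNorm_mono fun x => norm_fderiv_le_norm_grad ψ x) _)
      _ ≤ _ := by
          rw [hsupp]
          exact mul_le_mul_right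
            (eLpNorm_le_eLpNorm_mul_rpow_measure_univ (by norm_num) hg.1) _
  have hreal := ENNReal.toReal_mono
    (ENNReal.mul_ne_top ENNReal.coe_ne_top (ENNReal.mul_ne_top hg.eLpNorm_ne_top hm')) hle
  rw [ENNReal.toReal_mul, ENNReal.toReal_mul, ENNReal.coe_toReal] at hreal
  simp only [normSq]
  rw [← hψ.norm_toLp_sq, ← hg.norm_toLp_sq, ← mul_pow, Lp.norm_toLp, Lp.norm_toLp]
  refine pow_le_pow_left₀ ENNReal.toReal_nonneg (hreal.trans_eq ?_) 2
  ring

theorem exists_poincare (Ω : Set Plane) [IsFiniteMeasure (volume.restrict Ω)] :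
    ∃ C : ℝ, 0 < C ∧ Poincare Ω C := by
  obtain ⟨C, hC, hle⟩ := exists_poincare_smooth Ω
  refine ⟨C + 1, by positivity, fun φ Dφ h => ?_⟩
  obtain ⟨ψ, h1, h2, h3⟩ := h.approx
  have hlim := tendsto_integral_norm_sq
    (fun n => memLp_smooth (h1 n).1 (h1 n).2.1 (volume.restrict Ω)) h.memLp h2
  have hlim' := tendsto_integral_norm_sq
    (fun n => memLp_grad_smooth (h1 n).1 (h1 n).2.1 (volume.restrict Ω)) h.memLp_grad h3
  refine le_of_tendsto_of_tendsto hlim (hlim'.const_mul (C + 1)) (.of_forall fun n => ?_)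
  refine (hle (ψ n) (h1 n).1 (h1 n).2.1 (h1 n).2.2).trans ?_
  exact mul_le_mul_of_nonneg_right (by linarith) (integral_nonneg fun x => sq_nonneg _)

end H10

end SeaIce

/-! ### Viscous-plastic stress, forces and the final estimate. -/

namespace SeaIce

theorem tr_sym (G : Tensor) : tr (sym G) = tr G := by
  simp only [tr, sym]
  ring

theorem abs_tr_le (G : Tensor) : |tr G| ≤ 2 * ‖G‖ := by
  refine abs_le_of_sq_le_sq ?_ (by positivity)
  rw [mul_pow, norm_tensor_sq]
  simp only [tr]
  nlinarith [sq_nonneg (G (0, 0) - G (1, 1)), sq_nonneg (G (0, 1)), sq_nonneg (G (1, 0)),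
    sq_nonneg (G (0, 0)), sq_nonneg (G (1, 1))]

theorem inner_cross_self (u : Plane) : inner ℝ (cross u) u = 0 := by
  rw [PiLp.inner_apply]
  simp [cross, mul_comm]

theorem norm_cross (u : Plane) : ‖cross u‖ = ‖u‖ := by
  rw [← sq_eq_sq₀ (norm_nonneg _) (norm_nonneg _), EuclideanSpace.norm_sq_eq,
    EuclideanSpace.norm_sq_eq]
  simp [cross, add_comm]

theorem continuous_cross : Continuous cross := by
  unfold cross
  fun_prop

namespace Params

variable (p : Params)

theorem P_pos : 0 < p.P := mul_pos (mul_pos p.Pstar_pos p.h_pos) (Real.exp_pos _)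

theorem Δmin_le_Δ (ε : Tensor) : p.Δmin ≤ p.Δ ε :=
  Real.le_sqrt_of_sq_le (by
    have h1 : 0 ≤ 2 * (ecc ^ 2)⁻¹ * ‖SeaIce.dev ε‖ ^ 2 := by positivity
    have h2 : 0 ≤ tr ε ^ 2 := sq_nonneg _
    linarith)

theorem Δ_pos (ε : Tensor) : 0 < p.Δ ε := p.Δmin_pos.trans_le (p.Δmin_le_Δ ε)

theorem ζ_pos (ε : Tensor) : 0 < p.ζ ε :=
  div_pos p.P_pos (mul_pos two_pos (p.Δ_pos ε))

theorem ζ_le (ε : Tensor) : p.ζ ε ≤ p.P / (2 * p.Δmin) :=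
  div_le_div_of_nonneg_left p.P_pos.le (mul_pos two_pos p.Δmin_pos)
    (mul_le_mul_of_nonneg_left (p.Δmin_le_Δ ε) two_pos.le)

theorem η_eq (ε : Tensor) : p.η ε = p.ζ ε / 4 := by
  simp only [η, ecc]
  ring

theorem continuous_ζ : Continuous p.ζ := by
  have hdev : Continuous SeaIce.dev := continuous_id.sub
    ((continuous_tr.div_const 2).smul continuous_const)
  have hΔ : Continuous p.Δ := ((continuous_const.add
    (continuous_const.mul (hdev.norm.pow 2))).add (continuous_tr.pow 2)).sqrt
  exact continuous_const.div (continuous_const.mul hΔ)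
    fun ε => (mul_pos two_pos (p.Δ_pos ε)).ne'

theorem continuous_σ : Continuous p.σ := by
  have hη : Continuous p.η := p.continuous_ζ.mul continuous_const
  exact (((continuous_const.mul hη).smul continuous_id).add
    (((p.continuous_ζ.sub hη).mul continuous_tr).smul continuous_const)).sub continuous_const

/-- The threshold `Δmin` caps the viscosity, so the stress grows at most linearly and inherits
square integrability from the strain rate. -/
theorem norm_σ_le (ε : Tensor) : ‖p.σ ε‖ ≤
    p.P / (2 * p.Δmin) * (1 + 2 * ‖idTensor‖) * ‖ε‖ + ‖(p.P / 2) • idTensor‖ := by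
  have h0 := p.ζ_pos ε
  have h1 := p.ζ_le ε
  refine (norm_sub_le _ _).trans (add_le_add_left ((norm_add_le _ _).trans ?_) _)
  rw [norm_smul, norm_smul, p.η_eq, Real.norm_of_nonneg (by positivity), norm_mul,
    Real.norm_of_nonneg (by linarith : 0 ≤ p.ζ ε - p.ζ ε / 4), Real.norm_eq_abs]
  have h2 := abs_tr_le ε
  have h3 : 2 * (p.ζ ε / 4) * ‖ε‖ ≤ p.P / (2 * p.Δmin) * ‖ε‖ :=
    mul_le_mul_of_nonneg_right (by linarith) (norm_nonneg _)
  have h4 : (p.ζ ε - p.ζ ε / 4) * |tr ε| ≤ p.P / (2 * p.Δmin) * (2 * ‖ε‖) :=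
    mul_le_mul (by linarith) h2 (abs_nonneg _) (h0.le.trans h1)
  have h5 := mul_le_mul_of_nonneg_right h4 (norm_nonneg idTensor)
  linarith

theorem memLp_σ {α : Type*} [MeasurableSpace α] {μ : Measure α} [IsFiniteMeasure μ]
    {ε : α → Tensor} (hε : MemLp ε 2 μ) : MemLp (fun x => p.σ (ε x)) 2 μ := by
  refine ((hε.norm.const_mul (p.P / (2 * p.Δmin) * (1 + 2 * ‖idTensor‖))).add
    (memLp_const ‖(p.P / 2) • idTensor‖)).mono'
    (p.continuous_σ.comp_aestronglyMeasurable hε.1) (.of_forall fun x => p.norm_σ_le _)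

/-- With `η = ζ / 4` the shear part contributes `ζ / 2`, and the bulk part `3 / 4 * ζ * tr G ^ 2` is
nonnegative and dropped. -/
theorem le_inner_σ (G : Tensor) :
    p.ζ (sym G) / 2 * ‖sym G‖ ^ 2 - p.P / 2 * tr G ≤ inner ℝ (p.σ (sym G)) G := by
  have h : inner ℝ (p.σ (sym G)) G
      = p.ζ (sym G) / 2 * ‖sym G‖ ^ 2 + 3 / 4 * p.ζ (sym G) * tr G ^ 2 - p.P / 2 * tr G := by
    simp only [σ, p.η_eq]
    rw [inner_sub_left, inner_add_left, real_inner_smul_left, real_inner_smul_left,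
      real_inner_smul_left, real_inner_comm G idTensor, inner_idTensor, tr_sym]
    have : inner ℝ (sym G) G = ‖sym G‖ ^ 2 := by
      rw [norm_tensor_sq, inner_tensor]
      simp only [sym]
      ring
    rw [this]
    ring
  rw [h]
  have := mul_nonneg (mul_nonneg (by norm_num : (0 : ℝ) ≤ 3 / 4) (p.ζ_pos (sym G)).le)
    (sq_nonneg (tr G))
  linarith

theorem force_eq (a w u : Plane) :
    p.force a w u = p.R a w - (p.ρw * p.Cw1) • u - (p.ρ * p.h * p.f) • cross u := by
  simp only [force, τ, R, smul_sub]
  abel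

theorem inner_force (a w u : Plane) :
    inner ℝ (p.force a w u) u = inner ℝ (p.R a w) u - p.ρw * p.Cw1 * ‖u‖ ^ 2 := by
  rw [force_eq, inner_sub_left, inner_sub_left, real_inner_smul_left, real_inner_smul_left,
    inner_cross_self, real_inner_self_eq_norm_sq]
  ring

theorem memLp_force {α : Type*} [MeasurableSpace α] {μ : Measure α} {a w u : α → Plane}
    (hR : MemLp (fun z => p.R (a z) (w z)) 2 μ) (hu : MemLp u 2 μ) :
    MemLp (fun z => p.force (a z) (w z) (u z)) 2 μ := by
  have hc : MemLp (fun z => cross (u z)) 2 μ :=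
    hu.mono (continuous_cross.comp_aestronglyMeasurable hu.1)
      (.of_forall fun z => (norm_cross _).le)
  simp only [force_eq]
  exact (hR.sub (hu.const_smul (p.ρw * p.Cw1))).sub (hc.const_smul (p.ρ * p.h * p.f))

theorem ae_ζmin_le (Ω : Set Plane) (T : ℝ) (Dv : ℝ → Plane → Tensor) :
    ∀ᵐ t ∂(volume.restrict (Ioc 0 T)), ∀ᵐ x ∂(volume.restrict Ω),
      p.ζmin Ω T Dv ≤ p.ζ (sym (Dv t x)) := by
  have h : ∀ᵐ z ∂(spaceTime Ω T), p.ζmin Ω T Dv ≤ p.ζ (sym (Dv z.1 z.2)) :=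
    -- For real functions the essential infimum is an a.e. lower bound once some lower bound is
    -- known; here it is `0`.
    ae_essInf_le ⟨0, eventually_map.2 (.of_forall fun z => (p.ζ_pos _).le)⟩
  exact Measure.ae_ae_of_ae_prod h

/-- Coercivity of the viscous-plastic stress on `H¹₀(Ω)²`. -/
theorem coercive_σ {Ω : Set Plane} [IsFiniteMeasure (volume.restrict Ω)] {ck ζ₀ : ℝ}
    (hK : Korn Ω ck) (hζ₀ : 0 ≤ ζ₀) {φ : Plane → Plane} {Dφ : Plane → Tensor}
    (h : MemH10 Ω φ Dφ) (hζ : ∀ᵐ x ∂(volume.restrict Ω), ζ₀ ≤ p.ζ (sym (Dφ x))) :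
    ck * ζ₀ * normSq Ω Dφ ≤ 2 * ∫ x in Ω, inner ℝ (p.σ (sym (Dφ x))) (Dφ x) := by
  have hs := memLp_sym h.memLp_grad
  have htr : Integrable (fun x => tr (Dφ x)) (volume.restrict Ω) := by
    simpa only [inner_idTensor] using h.memLp_grad.integrable_inner_two (memLp_const idTensor)
  have h1 : ∫ x in Ω, (ζ₀ / 2 * ‖sym (Dφ x)‖ ^ 2 - p.P / 2 * tr (Dφ x))
      ≤ ∫ x in Ω, inner ℝ (p.σ (sym (Dφ x))) (Dφ x) := by
    refine integral_mono_ae ((hs.integrable_norm_sq.const_mul _).sub (htr.const_mul _))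
      ((p.memLp_σ hs).integrable_inner_two h.memLp_grad) ?_
    filter_upwards [hζ] with x hx
    have h2 := p.le_inner_σ (Dφ x)
    have h3 := mul_le_mul_of_nonneg_right hx (sq_nonneg ‖sym (Dφ x)‖)
    linarith
  rw [integral_sub (hs.integrable_norm_sq.const_mul _) (htr.const_mul _), integral_const_mul,
    integral_const_mul, h.integral_tr] at h1
  have h2 := mul_le_mul_of_nonneg_left (hK φ Dφ h) hζ₀
  simp only [normSq] at h2 ⊢
  linarith

/-- The power of the forces and stresses is controlled by the data up to dissipation. -/
theorem power_le {Ω : Set Plane} [IsFiniteMeasure (volume.restrict Ω)] {ck ζ₀ C : ℝ}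
    (hck : 0 < ck) (hK : Korn Ω ck) (hC : 0 < C) (hP : Poincare Ω C) (hζ₀ : 0 < ζ₀)
    {a w φ : Plane → Plane} {Dφ : Plane → Tensor}
    (hR : MemLp (fun x => p.R (a x) (w x)) 2 (volume.restrict Ω))
    (h : MemH10 Ω φ Dφ) (hζ : ∀ᵐ x ∂(volume.restrict Ω), ζ₀ ≤ p.ζ (sym (Dφ x))) :
    2 * ((∫ x in Ω, inner ℝ (p.force (a x) (w x) (φ x)) (φ x))
        - ∫ x in Ω, inner ℝ (p.σ (sym (Dφ x))) (Dφ x))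
      ≤ 2 * C / (ck * ζ₀) * normSq Ω (fun x => p.R (a x) (w x))
        - (2 * p.ρw * p.Cw1 * normSq Ω φ + ck * (ζ₀ / 4) * normSq Ω Dφ) := by
  have hσ := p.coercive_σ hK hζ₀.le h hζ
  have hk : 0 < ck * ζ₀ := mul_pos hck hζ₀
  simp only [inner_force]
  rw [integral_sub (hR.integrable_inner_two h.memLp) (h.memLp.integrable_norm_sq.const_mul _),
    integral_const_mul]
  -- The Young weight is chosen so that Poincaré turns the `φ` term into exactly half of the
  -- dissipation `ck * ζ₀ * ‖∇φ‖²`. The other half exceeds the quarter that is claimed.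
  have hyoung : 2 * ∫ x in Ω, inner ℝ (p.R (a x) (w x)) (φ x)
      ≤ 2 * C / (ck * ζ₀) * normSq Ω (fun x => p.R (a x) (w x))
        + ck * ζ₀ / (2 * C) * normSq Ω φ := by
    simp only [normSq]
    rw [← integral_const_mul, ← integral_const_mul, ← integral_const_mul,
      ← integral_add (hR.integrable_norm_sq.const_mul _) (h.memLp.integrable_norm_sq.const_mul _)]
    refine integral_mono ((hR.integrable_inner_two h.memLp).const_mul 2)
      ((hR.integrable_norm_sq.const_mul _).add (h.memLp.integrable_norm_sq.const_mul _))
      fun x => ?_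
    have h1 := real_inner_le_norm (p.R (a x) (w x)) (φ x)
    have h2 := mul_nonneg (inv_nonneg.2 (mul_pos (mul_pos two_pos hC) hk).le)
      (sq_nonneg (2 * C * ‖p.R (a x) (w x)‖ - ck * ζ₀ * ‖φ x‖))
    have h3 : (2 * C * (ck * ζ₀))⁻¹ * (2 * C * ‖p.R (a x) (w x)‖ - ck * ζ₀ * ‖φ x‖) ^ 2
        = 2 * C / (ck * ζ₀) * ‖p.R (a x) (w x)‖ ^ 2 + ck * ζ₀ / (2 * C) * ‖φ x‖ ^ 2
          - 2 * (‖p.R (a x) (w x)‖ * ‖φ x‖) := by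
      field_simp
      ring
    simp only
    linarith
  have hpoin : ck * ζ₀ / (2 * C) * normSq Ω φ ≤ ck * ζ₀ / 2 * normSq Ω Dφ := by
    have := mul_le_mul_of_nonneg_left (hP φ Dφ h) (div_pos hk (mul_pos two_pos hC)).le
    refine this.trans_eq ?_
    field_simp
  have hD : 0 ≤ ck * ζ₀ * normSq Ω Dφ := mul_nonneg hk.le (integral_nonneg fun x => sq_nonneg _)
  simp only [normSq] at *
  linarith

theorem IsWeakSolution.energy_le {p : Params} {Ω : Set Plane} (hΩ : IsOpen Ω)
    [IsFiniteMeasure (volume.restrict Ω)] {T : ℝ} (hT : 0 < T) {va vw v : ℝ → Plane → Plane}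
    {Dv : ℝ → Plane → Tensor}
    (hR : MemLp (fun z : ℝ × Plane => p.R (va z.1 z.2) (vw z.1 z.2)) 2 (spaceTime Ω T))
    (hv : p.IsWeakSolution Ω T va vw v Dv) :
    p.ρ * p.h * normSq Ω (v T) ≤ p.ρ * p.h * normSq Ω (v 0)
      + 2 * ∫ t in (0 : ℝ)..T,
          ((∫ x in Ω, inner ℝ (p.force (va t x) (vw t x) (v t x)) (v t x))
            - ∫ x in Ω, inner ℝ (p.σ (sym (Dv t x))) (Dv t x)) := by
  have : IsFiniteMeasure (spaceTime Ω T) := by unfold spaceTime; infer_instance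
  refine energy_inequality (V := MemH10 Ω) (F := fun t x => p.force (va t x) (vw t x) (v t x))
    (S := fun t x => p.σ (sym (Dv t x))) hT (mul_pos p.ρ_pos p.h_pos) hv.memL2H10.memLp
    hv.memL2H10.memLp_grad (p.memLp_force hR hv.memL2H10.memLp)
    (p.memLp_σ (memLp_sym hv.memL2H10.memLp_grad)) hv.memLp_slice
    (fun φ Dφ h => ⟨h.memLp, h.memLp_grad⟩) (fun w hw ε hε => ?_) hv.memL2H10.ae_mem hv.weak_eq
  obtain ⟨φ, h1, h2, h3, h4⟩ := exists_contDiff_tsupport_subset_integral_sq_le hΩ hw hε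
  exact ⟨φ, grad φ, memH10_of_contDiff h1 h2 h3, h4⟩

theorem IsWeakSolution.estimate {p : Params} {Ω : Set Plane} (hΩ : IsOpen Ω)
    [IsFiniteMeasure (volume.restrict Ω)] {ck C : ℝ} (hck : 0 < ck) (hK : Korn Ω ck)
    (hC : 0 < C) (hP : Poincare Ω C) {T : ℝ} (hT : 0 < T) {va vw v : ℝ → Plane → Plane}
    {Dv : ℝ → Plane → Tensor}
    (hR : MemLp (fun z : ℝ × Plane => p.R (va z.1 z.2) (vw z.1 z.2)) 2 (spaceTime Ω T))
    (hv : p.IsWeakSolution Ω T va vw v Dv) (hζ : 0 < p.ζmin Ω T Dv) :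
    p.ρ * p.h * normSq Ω (v T)
        + (∫ t in (0 : ℝ)..T, (2 * p.ρw * p.Cw1 * normSq Ω (v t)
            + ck * (p.ζmin Ω T Dv / 4) * normSq Ω (Dv t)))
      ≤ (∫ t in (0 : ℝ)..T, 2 * C / (ck * p.ζmin Ω T Dv)
            * normSq Ω (fun x => p.R (va t x) (vw t x))) + p.ρ * p.h * normSq Ω (v 0) := by
  have hfin : IsFiniteMeasure (spaceTime Ω T) := by unfold spaceTime; infer_instance
  have hE := hv.energy_le hΩ hT hR
  have hRi : IntegrableOn (fun t => normSq Ω (fun x => p.R (va t x) (vw t x))) (Ioc 0 T) :=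
    hR.integrable_norm_sq.integral_prod_left
  have hvi : IntegrableOn (fun t => normSq Ω (v t)) (Ioc 0 T) :=
    hv.memL2H10.memLp.integrable_norm_sq.integral_prod_left
  have hDi : IntegrableOn (fun t => normSq Ω (Dv t)) (Ioc 0 T) :=
    hv.memL2H10.memLp_grad.integrable_norm_sq.integral_prod_left
  have hFi : IntegrableOn (fun t => ∫ x in Ω, inner ℝ (p.force (va t x) (vw t x) (v t x)) (v t x))
      (Ioc 0 T) :=
    ((p.memLp_force hR hv.memL2H10.memLp).integrable_inner_two
      hv.memL2H10.memLp).integral_prod_left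
  have hSi : IntegrableOn (fun t => ∫ x in Ω, inner ℝ (p.σ (sym (Dv t x))) (Dv t x)) (Ioc 0 T) :=
    ((p.memLp_σ (memLp_sym hv.memL2H10.memLp_grad)).integrable_inner_two
      hv.memL2H10.memLp_grad).integral_prod_left
  have hdiss := (hvi.const_mul (2 * p.ρw * p.Cw1)).add
    (hDi.const_mul (ck * (p.ζmin Ω T Dv / 4)))
  have hpow : 2 * ∫ t in Ioc 0 T,
        ((∫ x in Ω, inner ℝ (p.force (va t x) (vw t x) (v t x)) (v t x))
          - ∫ x in Ω, inner ℝ (p.σ (sym (Dv t x))) (Dv t x))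
      ≤ (∫ t in Ioc 0 T, 2 * C / (ck * p.ζmin Ω T Dv)
            * normSq Ω (fun x => p.R (va t x) (vw t x)))
        - ∫ t in Ioc 0 T, (2 * p.ρw * p.Cw1 * normSq Ω (v t)
            + ck * (p.ζmin Ω T Dv / 4) * normSq Ω (Dv t)) := by
    rw [← integral_const_mul, ← integral_sub (hRi.const_mul _) (by exact hdiss)]
    refine integral_mono_ae ((hFi.sub hSi).const_mul 2) ((hRi.const_mul _).sub hdiss) ?_
    have hRs : ∀ᵐ t ∂(volume.restrict (Ioc 0 T)),
        MemLp (fun x => p.R (va t x) (vw t x)) 2 (volume.restrict Ω) :=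
      MemLp.ae_slice (f := fun t x => p.R (va t x) (vw t x)) hR
    filter_upwards [hRs, hv.memL2H10.ae_mem, p.ae_ζmin_le Ω T Dv] with t h1 h2 h3
    exact p.power_le hck hK hC hP hζ h1 h2 h3
  simp only [intervalIntegral.integral_of_le hT.le] at hE ⊢
  linarith

end Params

end SeaIce

theorem theorem1 (Ω : Set SeaIce.Plane) (hΩ_open : IsOpen Ω) (hΩ_bdd : Bornology.IsBounded Ω) :
    (∃ ck : ℝ, 0 < ck ∧ SeaIce.Korn Ω ck) ∧
    ∃ cp : ℝ, 0 < cp ∧ SeaIce.Poincare Ω cp ∧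
      ∀ ck : ℝ, 0 < ck → SeaIce.Korn Ω ck →
      ∀ (p : SeaIce.Params) (T : ℝ), 0 < T →
      ∀ va vw : ℝ → SeaIce.Plane → SeaIce.Plane,
        MeasureTheory.MemLp (fun z : ℝ × SeaIce.Plane => p.R (va z.1 z.2) (vw z.1 z.2)) 2
          (SeaIce.spaceTime Ω T) →
      ∀ (v : ℝ → SeaIce.Plane → SeaIce.Plane) (Dv : ℝ → SeaIce.Plane → SeaIce.Tensor),
        p.IsWeakSolution Ω T va vw v Dv →
        0 < p.ζmin Ω T Dv →
        p.ρ * p.h * SeaIce.normSq Ω (v T)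
          + (∫ t in (0 : ℝ)..T, (2 * p.ρw * p.Cw1 * SeaIce.normSq Ω (v t)
              + ck * (p.ζmin Ω T Dv / 4) * SeaIce.normSq Ω (Dv t)))
        ≤ (∫ t in (0 : ℝ)..T, cp / (ck * p.ζmin Ω T Dv)
              * SeaIce.normSq Ω (fun x => p.R (va t x) (vw t x)))
          + p.ρ * p.h * SeaIce.normSq Ω (v 0) := by
  have : IsFiniteMeasure (volume.restrict Ω) :=
    ⟨by rw [Measure.restrict_apply_univ]; exact hΩ_bdd.measure_lt_top⟩
  obtain ⟨C, hC, hP⟩ := SeaIce.exists_poincare Ω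
  -- The factor `2` pays for Young's inequality: `2 * C` is still a Poincaré constant, and it is the
  -- one that appears in front of `‖R‖²`.
  refine ⟨⟨1 / 2, by norm_num, SeaIce.korn_half Ω⟩, 2 * C, by positivity, fun φ Dφ h => ?_, ?_⟩
  · refine (hP φ Dφ h).trans (mul_le_mul_of_nonneg_right (by linarith) ?_)
    exact integral_nonneg fun x => sq_nonneg _
  · intro ck hck hK p T hT va vw hR v Dv hv hζ
    exact hv.estimate hΩ_open hck hK hC hP hT hR hζ
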